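/- **Lemma (Inverse inequality).** Let $\Lambda=(-1,1)$ and $\alpha>0$. For $n\in\mathbb N_0$ let $P_n^{\alpha,\alpha}$ be the classical Jacobi polynomial (orthogonal on $\Lambda$ with respect to the weight $(1-x^2)^\alpha$, normalized by $P_n^{\alpha,\alpha}(1)=\Gamma(n+\alpha+1)/(n!\,\Gamma(\alpha+1))$), and for $N\ge 1$ let $$\mathbb F_N=\operatorname{span}\{(1-x^2)^\alpha P_n^{\alpha,\alpha}(x):\ 0\le n\le N\}$$ (complex coefficients allowed). For $s>0$ and the integer $k$ with $s\in[k-1,k)$, the Riesz fractional derivative on $\Lambda$ is $$D^s v(x)=\frac{(-1)^{\lfloor (s+1)/2\rfloor}}{2\cos(\pi s/2)\,\Gamma(k-s)}\,\Big[\frac{d^k}{dx^k}\int_{-1}^x \frac{v(t)}{(x-t)^{s-k+1}}\,dt+(-1)^k\frac{d^k}{dx^k}\int_x^1 \frac{v(t)}{(t-x)^{s-k+1}}\,dt\Big],\qquad x\in\Lambda,$$ when $s$ is not an odd integer, and $D^s v(x)=\lim_{r\downarrow s}D^r v(x)$ when $s$ is an odd integer. Let $\|v\|^2=\int_{-1}^1|v(x)|^2\,dx$,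 and $$|v|_{s,*}^2=\frac1{2\pi}\int_{\mathbb R}|\xi|^{2s}\,\Big|\int_{-1}^1 v(x)e^{-i\xi x}\,dx\Big|^2\,d\xi$$ (the squared $L^2(\mathbb R)$-norm of the Riesz derivative of order $s$ of the extension of $v$ by zero). Then there is a constant $C>0$, depending only on $\alpha$, such that for every integer $N\ge1$ and every $u_N\in\mathbb F_N$: $D^\alpha u_N$ exists at every point of $\Lambda$ and belongs to $L^2(\Lambda)$, $|u_N|_{\alpha,*}$ is finite, and $$\|D^\alpha u_N\|^2\le C\,N^{4\alpha}\,\|u_N\|^2\qquad\text{and}\qquad |u_N|_{\alpha,*}^2\le C\,N^{4\alpha}\,\|u_N\|^2 .$$ -/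

import Mathlib

open MeasureTheory Filter Topology Set
open scoped Polynomial

noncomputable section

namespace RieszJacobi

/-- The open interval `Λ = (-1, 1)`. -/
def Lam : Set ℝ := Ioo (-1) 1

/-- The classical Jacobi polynomial `P_n^{a,b}` (in the usual normalization, with
`P_n^{a,b}(1) = (a+1)_n / n!`), by the explicit formula
`P_n^{a,b}(x) = ∑_m (n+a+b+1)_m (a+m+1)_{n-m} / (m! (n-m)!) ((x-1)/2)^m`,
where `(c)_m` is the rising factorial. -/
def jacobiP (a b : ℝ) (n : ℕ) : ℝ[X] :=
  ∑ m ∈ Finset.range (n + 1),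
    Polynomial.C ((ascPochhammer ℝ m).eval (n + a + b + 1) *
        (ascPochhammer ℝ (n - m)).eval (a + m + 1) /
        ((m.factorial : ℝ) * ((n - m).factorial : ℝ))) *
      (Polynomial.C (1 / 2) * (Polynomial.X - 1)) ^ m

/-- The generalized Jacobi function `(1 - x^2)^α P_n^{α,α}(x)`; only its values on `Λ` matter. -/
def genJacobi (α : ℝ) (n : ℕ) (x : ℝ) : ℂ :=
  (((1 - x ^ 2) ^ α * (jacobiP α α n).eval x : ℝ) : ℂ)

/-- The space spanned by the generalized Jacobi functions with index `n ≤ N`. -/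
def FN (α : ℝ) (N : ℕ) : Submodule ℂ (ℝ → ℂ) :=
  Submodule.span ℂ {f | ∃ n : ℕ, n ≤ N ∧ f = genJacobi α n}

/-- Left fractional integral of order `ρ > 0` on `Λ`. -/
def leftInt (ρ : ℝ) (v : ℝ → ℂ) (x : ℝ) : ℂ :=
  (((Real.Gamma ρ)⁻¹ : ℝ) : ℂ) * ∫ t in (-1 : ℝ)..x, (((x - t) ^ (ρ - 1) : ℝ) : ℂ) * v t

/-- Right fractional integral of order `ρ > 0` on `Λ`. -/
def rightInt (ρ : ℝ) (v : ℝ → ℂ) (x : ℝ) : ℂ :=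
  (((Real.Gamma ρ)⁻¹ : ℝ) : ℂ) * ∫ t in x..(1 : ℝ), (((t - x) ^ (ρ - 1) : ℝ) : ℂ) * v t

/-- For `s ≥ 0`, the positive integer `k` with `s ∈ [k - 1, k)`. -/
def ceilOrder (s : ℝ) : ℕ := ⌊s⌋₊ + 1

/-- Left Riemann-Liouville derivative of order `s ≥ 0`. -/
def leftDeriv (s : ℝ) (v : ℝ → ℂ) (x : ℝ) : ℂ :=
  iteratedDeriv (ceilOrder s) (leftInt (ceilOrder s - s) v) x

/-- Right Riemann-Liouville derivative of order `s ≥ 0`. -/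
def rightDeriv (s : ℝ) (v : ℝ → ℂ) (x : ℝ) : ℂ :=
  (-1) ^ ceilOrder s * iteratedDeriv (ceilOrder s) (rightInt (ceilOrder s - s) v) x

/-- The fractional integrals and derivatives of order `s` of `v` exist classically on `Λ`: the
fractional integrals of order `k - s` converge absolutely at each point and are of class `C^k`. -/
def RLDefined (s : ℝ) (v : ℝ → ℂ) : Prop :=
  (∀ x ∈ Lam,
    IntervalIntegrable (fun t => (((x - t) ^ ((ceilOrder s - s) - 1) : ℝ) : ℂ) * v t)
      volume (-1) x ∧
    IntervalIntegrable (fun t => (((t - x) ^ ((ceilOrder s - s) - 1) : ℝ) : ℂ) * v t)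
      volume x 1) ∧
  ContDiffOn ℝ (ceilOrder s) (leftInt (ceilOrder s - s) v) Lam ∧
  ContDiffOn ℝ (ceilOrder s) (rightInt (ceilOrder s - s) v) Lam

/-- `s` is an odd positive integer. -/
def IsOddOrder (s : ℝ) : Prop := ∃ m : ℕ, s = 2 * m + 1

/-- The expression defining the Riesz derivative of order `s` when `s` is not an odd integer. -/
def rieszExpr (s : ℝ) (v : ℝ → ℂ) (x : ℝ) : ℂ :=
  (((-1) ^ ⌊(s + 1) / 2⌋₊ / (2 * Real.cos (Real.pi * s / 2)) : ℝ) : ℂ) *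
    (leftDeriv s v x + rightDeriv s v x)

open Classical in
/-- The Riesz fractional derivative `D^s v` on `Λ`. At an odd integer `s`, where the cosine
vanishes, it is the limit of `D^r v` as `r` decreases to `s`, that is, with `r` in the same
interval `[k - 1, k)` as `s` (the sign factor `(-1)^⌊(r+1)/2⌋` jumps when `r` passes `s`). -/
def rieszDeriv (s : ℝ) (v : ℝ → ℂ) (x : ℝ) : ℂ :=
  if IsOddOrder s then limUnder (𝓝[>] s) (fun r => rieszExpr r v x) else rieszExpr s v x

/-- `D^s v` exists at every point of `Λ`: all derivatives in its definition exist, and so does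
the limit when `s` is an odd integer. -/
def RieszDefined (s : ℝ) (v : ℝ → ℂ) : Prop :=
  (¬ IsOddOrder s → RLDefined s v) ∧
  (IsOddOrder s → (∀ᶠ r in 𝓝[>] s, RLDefined r v) ∧
    ∀ x ∈ Lam, ∃ l : ℂ, Tendsto (fun r => rieszExpr r v x) (𝓝[>] s) (𝓝 l))

/-- The squared norm of `L²(Λ)`. -/
def normSq (v : ℝ → ℂ) : ℝ := ∫ x in Lam, ‖v x‖ ^ 2

/-- The Fourier transform `∫ e^{-iξx} v(x) dx` of the extension of `v` by zero outside `Λ`. -/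
def fourierExt (v : ℝ → ℂ) (ξ : ℝ) : ℂ :=
  ∫ x in Lam, Complex.exp (-(Complex.I * ξ * x)) * v x

/-- The squared seminorm `|v|_{s,*}^2` of the zero extension of `v` in `H^s(ℝ)`. -/
def seminormSq (s : ℝ) (v : ℝ → ℂ) : ℝ :=
  1 / (2 * Real.pi) * ∫ ξ : ℝ, |ξ| ^ (2 * s) * ‖fourierExt v ξ‖ ^ 2

end RieszJacobi

end

/-! ### Growth and derivative bounds for polynomials bounded on `[-1, 1]` -/

noncomputable section
namespace RieszJacobi

/-! Orthogonality plays no role: every element of `FN α N` is `u = (1 - x²)^α p` with `deg p ≤ N`,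
and the estimates hold for all such `u`. Let `S` be the maximum of `|p|` on `[-1, 1]`.

The frequency scale is `N²`. Below it, `|ξ|^{2α} ≤ N^{4α}` and Plancherel
(`integral_normSq_fourierExt_le`) gives the bound at once. Above it the Fourier transform decays
like `S |ξ|^{-α-1}` (`exists_norm_fourierExt_le`). To see this, shift the contour from `[-1, 1]`
into the half plane where `e^{-iξz}` decays; only the vertical rays from `±1` remain. At depth `y`
the polynomial is at most `S e^{2N√y}` by Bernstein's growth estimate (`norm_eval_le_exp`), and `N√y
≤ √(ξy)`, so the factor `e^{-ξy}` wins; the zero of order `α` of the weight at `±1` yields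
`ξ^{-α-1}`. The tail of the seminorm is then of order `S² ∫_{|ξ| > N²} ξ^{-2} dξ`, that is, of order
`S² N^{-2}`. The weighted Nikolskii inequality `exists_sq_norm_eval_le`, namely `S² ≤ C N^{4α+2}
‖u‖²`, turns this into `N^{4α} ‖u‖²`.

The Riesz derivative on `Λ` is controlled by the seminorm through duality. Tested against a smooth
`φ` supported in `Λ`, the sum of the two Riemann-Liouville derivatives becomes a Fourier integral
with symbol `(iξ)^s + (-iξ)^s = 2 cos(πs/2) |ξ|^s` (`lineInt_add_lineInt_neg`), and the cosine
cancels against the normalization. Choosing for `φ` a cutoff of the conjugate of the derivative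
gives `‖D^s u‖ ≤ |u|_{s,*}` (`normSq_rieszExpr_le`).

At an odd integer the cosine vanishes. Near a point, `u` splits into a smooth compactly supported
part, on which the cosine cancels exactly, and a part at positive distance, whose coefficient has a
zero that compensates that of the cosine. Hence the limit exists (`exists_tendsto_rieszExpr`), and
Fatou's lemma carries the norm bound over to it. -/

/-- The inverse of the Joukowski map, with values in the punctured closed unit disc. -/
lemma exists_joukowski (z : ℂ) : ∃ w : ℂ, w ≠ 0 ∧ ‖w‖ ≤ 1 ∧ z = (w + w⁻¹) / 2 := by
  obtain ⟨s, hs⟩ := IsAlgClosed.exists_pow_nat_eq (z ^ 2 - 1) (n := 2) (by norm_num)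
  have h1 : (z + s) * (z - s) = 1 := by linear_combination -hs
  have ha : z + s ≠ 0 := left_ne_zero_of_mul_eq_one h1
  have hb : z - s ≠ 0 := right_ne_zero_of_mul_eq_one h1
  have hn : ‖z + s‖ * ‖z - s‖ = 1 := by rw [← norm_mul, h1, norm_one]
  rcases le_total ‖z + s‖ 1 with h | h
  · refine ⟨z + s, ha, h, ?_⟩
    rw [inv_eq_of_mul_eq_one_right h1]; ring
  · refine ⟨z - s, hb, ?_, ?_⟩
    · nlinarith [norm_nonneg (z - s)]
    · rw [inv_eq_of_mul_eq_one_left h1]; ring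

/-- The Joukowski map sends circles about `0` to ellipses with foci `±1`. Since `z ∓ 1 = (w ∓ 1)² /
(2w)`, the sum of the focal distances comes from the parallelogram law. -/
lemma joukowski_norm {w : ℂ} (hw : w ≠ 0) :
    ‖(w + w⁻¹) / 2 - 1‖ + ‖(w + w⁻¹) / 2 + 1‖ = ‖w‖ + ‖w‖⁻¹ := by
  have h1 : (w + w⁻¹) / 2 - 1 = (w - 1) ^ 2 / (2 * w) := by field_simp; ring
  have h2 : (w + w⁻¹) / 2 + 1 = (w + 1) ^ 2 / (2 * w) := by field_simp; ring
  have h0 : ‖w‖ ≠ 0 := norm_ne_zero_iff.2 hw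
  have h3 := parallelogram_law_with_norm ℝ w 1
  rw [h1, h2]
  simp only [norm_div, norm_pow, norm_mul, Complex.norm_ofNat]
  rw [norm_one] at h3
  field_simp
  nlinarith

/-- With `ρ = e^θ` the hypothesis reads `cosh θ ≤ 1 + s²`, so that in fact `θ ≤ √2 s`. The larger
constant `2` allows a comparison with `1 + 2s + 2s² ≤ e^{2s}` only. -/
lemma le_exp_of_add_inv_le {ρ s : ℝ} (hρ : 1 ≤ ρ) (hs : 0 ≤ s) (h : ρ + ρ⁻¹ ≤ 2 + 2 * s ^ 2) :
    ρ ≤ Real.exp (2 * s) := by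
  have h1 : (ρ - 1) ^ 2 ≤ 2 * s ^ 2 * ρ := by
    have h0 : 0 < ρ := by linarith
    have : (ρ + ρ⁻¹) * ρ ≤ (2 + 2 * s ^ 2) * ρ := by gcongr
    rw [add_mul, inv_mul_cancel₀ h0.ne'] at this
    nlinarith
  refine le_trans ?_ (Real.quadratic_le_exp_of_nonneg (by positivity))
  by_contra! hc
  nlinarith [mul_nonneg hs hs, mul_nonneg (mul_nonneg hs hs) hs, sq_nonneg (ρ - (1 + 2 * s + (2 * s) ^ 2 / 2))]

/-- Bernstein's growth estimate for a polynomial bounded on `[-1, 1]`. -/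
theorem norm_eval_le_exp {p : ℂ[X]} {N : ℕ} (hN : p.natDegree ≤ N) {S : ℝ}
    (hS : ∀ x : ℝ, x ∈ Icc (-1 : ℝ) 1 → ‖p.eval (x : ℂ)‖ ≤ S) {z : ℂ} {r : ℝ} (hr : 0 ≤ r)
    (hz : ‖z - 1‖ + ‖z + 1‖ ≤ 2 + 2 * r) : ‖p.eval z‖ ≤ S * Real.exp (2 * N * √r) := by
  obtain ⟨w, hw0, hw1, rfl⟩ := exists_joukowski z
  rw [joukowski_norm hw0] at hz
  have hS0 : 0 ≤ S := (norm_nonneg _).trans (hS 0 (by constructor <;> norm_num))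
  -- This is `w^N p((w + w⁻¹)/2)` with the pole at `0` cleared. The unit circle is mapped into `[-1,
  -- 1]`, so the maximum principle bounds `q` by `S` on the whole disc.
  let q : ℂ → ℂ := fun w => ∑ i ∈ Finset.range (N + 1),
    p.coeff i * ((w ^ 2 + 1) ^ i / 2 ^ i * w ^ (N - i))
  have hq : ∀ w : ℂ, w ≠ 0 → q w = w ^ N * p.eval ((w + w⁻¹) / 2) := by
    intro w hw
    rw [Polynomial.eval_eq_sum_range' (Nat.lt_succ_of_le hN), Finset.mul_sum]
    refine Finset.sum_congr rfl fun i hi => ?_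
    have hi' : i ≤ N := Nat.lt_succ_iff.1 (Finset.mem_range.1 hi)
    have h1 : (w + w⁻¹) / 2 = (w ^ 2 + 1) / (2 * w) := by field_simp
    rw [h1, div_pow, mul_pow, ← Nat.sub_add_cancel hi', pow_add, Nat.add_sub_cancel]
    field_simp
  have hqd : Differentiable ℂ q := by
    intro w
    simp only [q]
    fun_prop
  have hfr : ∀ w ∈ frontier (Metric.ball (0 : ℂ) 1), ‖q w‖ ≤ S := by
    intro w hw
    rw [frontier_ball _ one_ne_zero, mem_sphere_zero_iff_norm] at hw
    have hw' : w ≠ 0 := by rintro rfl; simp at hw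
    have h2 : (w + w⁻¹) / 2 = (w.re : ℂ) := by
      rw [Complex.inv_eq_conj hw, Complex.add_conj]; push_cast; ring
    rw [hq w hw', norm_mul, norm_pow, hw, one_pow, one_mul, h2]
    exact hS _ (abs_le.1 (hw ▸ Complex.abs_re_le_norm w))
  have hle : ‖q w‖ ≤ S := Complex.norm_le_of_forall_mem_frontier_norm_le Metric.isBounded_ball
    hqd.diffContOnCl hfr (by rw [closure_ball _ one_ne_zero]; simpa using hw1)
  have hwpos : 0 < ‖w‖ := norm_pos_iff.2 hw0
  have hρ : ‖w‖⁻¹ ≤ Real.exp (2 * √r) := by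
    refine le_exp_of_add_inv_le ((one_le_inv₀ hwpos).2 hw1) (Real.sqrt_nonneg r) ?_
    rw [inv_inv, Real.sq_sqrt hr]; linarith
  have h3 : ‖p.eval ((w + w⁻¹) / 2)‖ = ‖q w‖ * ‖w‖⁻¹ ^ N := by
    rw [hq w hw0, norm_mul, norm_pow, inv_pow, mul_right_comm,
      mul_inv_cancel₀ (pow_pos hwpos N).ne', one_mul]
  rw [h3, show 2 * (N : ℝ) * √r = N * (2 * √r) by ring, Real.exp_nat_mul]
  gcongr

/-- A Markov inequality, with a constant that is not sharp. -/
theorem norm_deriv_eval_le {p : ℂ[X]} {N : ℕ} (hN : p.natDegree ≤ N) (hN1 : 1 ≤ N) {S : ℝ}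
    (hS : ∀ x : ℝ, x ∈ Icc (-1 : ℝ) 1 → ‖p.eval (x : ℂ)‖ ≤ S) {x : ℝ} (hx : x ∈ Icc (-1 : ℝ) 1) :
    ‖deriv (fun z => p.eval z) (x : ℂ)‖ ≤ Real.exp 2 * N ^ 2 * S := by
  have hN0 : (0 : ℝ) < N := by exact_mod_cast hN1
  -- Cauchy's estimate on a circle of radius `1/N²`, the distance at which the growth factor
  -- `e^{2N√r}` is still the constant `e²`.
  have key := Complex.norm_deriv_le_of_forall_mem_sphere_norm_le (c := (x : ℂ)) (R := 1 / (N : ℝ) ^ 2)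
    (C := S * Real.exp 2) (f := fun z => p.eval z) (by positivity)
    (p.differentiable.diffContOnCl) ?_
  · refine key.trans (le_of_eq ?_)
    field_simp
  · intro z hz
    rw [mem_sphere_iff_norm] at hz
    have h1 : ‖z - 1‖ ≤ 1 / (N : ℝ) ^ 2 + (1 - x) := by
      have := norm_add_le (z - x) ((x : ℂ) - 1)
      have h' : ‖(x : ℂ) - 1‖ = 1 - x := by
        rw [← Complex.ofReal_one, ← Complex.ofReal_sub, Complex.norm_real, Real.norm_eq_abs,
          abs_of_nonpos (by linarith [hx.2])]; ring
      rw [sub_add_sub_cancel, hz, h'] at this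
      exact this
    have h2 : ‖z + 1‖ ≤ 1 / (N : ℝ) ^ 2 + (1 + x) := by
      have := norm_add_le (z - x) ((x : ℂ) + 1)
      have h' : ‖(x : ℂ) + 1‖ = 1 + x := by
        rw [← Complex.ofReal_one, ← Complex.ofReal_add, Complex.norm_real, Real.norm_eq_abs,
          abs_of_nonneg (by linarith [hx.1])]; ring
      rw [show z - x + ((x : ℂ) + 1) = z + 1 by ring, hz, h'] at this
      exact this
    refine (norm_eval_le_exp hN hS (r := 1 / (N : ℝ) ^ 2) (by positivity) (by linarith)).trans
      (le_of_eq ?_)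
    rw [Real.sqrt_div zero_le_one, Real.sqrt_sq hN0.le, Real.sqrt_one]
    field_simp

lemma norm_eval_sub_le {p : ℂ[X]} {N : ℕ} (hN : p.natDegree ≤ N) (hN1 : 1 ≤ N) {S : ℝ}
    (hS : ∀ x : ℝ, x ∈ Icc (-1 : ℝ) 1 → ‖p.eval (x : ℂ)‖ ≤ S) {x y : ℝ}
    (hx : x ∈ Icc (-1 : ℝ) 1) (hy : y ∈ Icc (-1 : ℝ) 1) :
    ‖p.eval (y : ℂ) - p.eval (x : ℂ)‖ ≤ Real.exp 2 * N ^ 2 * S * |y - x| := by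
  have := Convex.norm_image_sub_le_of_norm_deriv_le (𝕜 := ℝ) (f := fun t : ℝ => p.eval (t : ℂ))
    (C := Real.exp 2 * N ^ 2 * S) (s := Icc (-1 : ℝ) 1) (x := x) (y := y) ?_ ?_
    (convex_Icc _ _) hx hy
  · simpa using this
  · intro t _
    exact (p.differentiable.differentiableAt.hasDerivAt.comp_ofReal).differentiableAt
  · intro t ht
    have : deriv (fun t : ℝ => p.eval (t : ℂ)) t = deriv (fun z => p.eval z) (t : ℂ) :=
      (p.differentiable.differentiableAt.hasDerivAt.comp_ofReal).deriv
    rw [this]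
    exact norm_deriv_eval_le hN hN1 hS ht

/-- The Jacobi-weighted polynomial attached to `p`. -/
def weighted (α : ℝ) (p : ℂ[X]) (x : ℝ) : ℂ := (((1 - x ^ 2) ^ α : ℝ) : ℂ) * p.eval (x : ℂ)

/-- The only information about Jacobi polynomials that the proof needs is their degree. -/
lemma exists_eq_weighted {α : ℝ} {N : ℕ} {u : ℝ → ℂ} (hu : u ∈ FN α N) :
    ∃ p : ℂ[X], p.natDegree ≤ N ∧ u = weighted α p := by
  induction hu using Submodule.span_induction with
  | mem f hf =>
    obtain ⟨n, hn, rfl⟩ := hf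
    refine ⟨(jacobiP α α n).map (algebraMap ℝ ℂ), ?_, ?_⟩
    · refine Polynomial.natDegree_map_le.trans (le_trans ?_ hn)
      refine Polynomial.natDegree_sum_le_of_forall_le _ _ fun m hm => ?_
      refine (Polynomial.natDegree_C_mul_le _ _).trans (Polynomial.natDegree_pow_le.trans ?_)
      have h1 : (Polynomial.C (1 / 2 : ℝ) * (Polynomial.X - 1)).natDegree ≤ 1 :=
        (Polynomial.natDegree_C_mul_le _ _).trans
          ((Polynomial.natDegree_sub_le _ _).trans (by simp))
      have := Finset.mem_range.1 hm
      nlinarith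
    · funext x
      simp [weighted, genJacobi, Polynomial.eval_map_algebraMap, ← Complex.coe_algebraMap, Polynomial.aeval_algebraMap_apply]
  | zero => exact ⟨0, by simp, by funext x; simp [weighted]⟩
  | add f g _ _ hf hg =>
    obtain ⟨p, hp, rfl⟩ := hf
    obtain ⟨q, hq, rfl⟩ := hg
    exact ⟨p + q, (Polynomial.natDegree_add_le _ _).trans (max_le hp hq), by
      funext x; simp [weighted, mul_add]⟩
  | smul a f _ hf =>
    obtain ⟨p, hp, rfl⟩ := hf
    exact ⟨a • p, (Polynomial.natDegree_smul_le _ _).trans hp, by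
      funext x; simp [weighted]; ring⟩

lemma one_sub_sq_pos {x : ℝ} (hx : x ∈ Lam) : 0 < 1 - x ^ 2 := by
  have := hx.1; have := hx.2; nlinarith

lemma norm_weighted {α : ℝ} {p : ℂ[X]} {x : ℝ} (hx : x ∈ Lam) :
    ‖weighted α p x‖ = (1 - x ^ 2) ^ α * ‖p.eval (x : ℂ)‖ := by
  rw [weighted, norm_mul, Complex.norm_real, Real.norm_of_nonneg]
  exact Real.rpow_nonneg (one_sub_sq_pos hx).le _

lemma norm_weighted_le {α : ℝ} (hα : 0 < α) {p : ℂ[X]} {S : ℝ}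
    (hS : ∀ x : ℝ, x ∈ Icc (-1 : ℝ) 1 → ‖p.eval (x : ℂ)‖ ≤ S) {x : ℝ} (hx : x ∈ Lam) :
    ‖weighted α p x‖ ≤ S := by
  rw [norm_weighted hx]
  have h1 := one_sub_sq_pos hx
  calc _ ≤ 1 * ‖p.eval (x : ℂ)‖ := by
        gcongr
        exact Real.rpow_le_one h1.le (by nlinarith [sq_nonneg x]) hα.le
    _ ≤ S := by rw [one_mul]; exact hS x ⟨hx.1.le, hx.2.le⟩

lemma exists_bound_eval (p : ℂ[X]) : ∃ x₀ ∈ Icc (-1 : ℝ) 1,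
    ∀ x : ℝ, x ∈ Icc (-1 : ℝ) 1 → ‖p.eval (x : ℂ)‖ ≤ ‖p.eval (x₀ : ℂ)‖ := by
  have hc : ContinuousOn (fun x : ℝ => ‖p.eval (x : ℂ)‖) (Icc (-1 : ℝ) 1) := by
    apply Continuous.continuousOn
    have := p.continuous
    fun_prop
  obtain ⟨x₀, h0, h1⟩ := isCompact_Icc.exists_isMaxOn ⟨(0 : ℝ), by norm_num⟩ hc
  exact ⟨x₀, h0, fun x hx => h1 hx⟩

lemma contDiffOn_weighted (α : ℝ) (p : ℂ[X]) {n : ℕ∞} : ContDiffOn ℝ n (weighted α p) Lam := by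
  have h1 : ContDiff ℝ n (fun x : ℝ => p.eval (x : ℂ)) := by
    have : ContDiff ℂ n (fun z : ℂ => p.eval z) := by
      simpa [Polynomial.coe_aeval_eq_eval] using p.contDiff_aeval (𝕜 := ℂ) n
    exact (this.restrict_scalars ℝ).comp Complex.ofRealCLM.contDiff
  have h2 : ContDiffOn ℝ n (fun x : ℝ => (1 - x ^ 2) ^ α) Lam := by
    intro x hx
    refine ContDiffAt.contDiffWithinAt ?_
    exact ContDiffAt.rpow_const_of_ne (by fun_prop) (one_sub_sq_pos hx).ne'
  exact (Complex.ofRealCLM.contDiff.comp_contDiffOn h2).mul h1.contDiffOn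

end RieszJacobi
end

/-! ### Weighted Nikolskii inequality -/

noncomputable section
namespace RieszJacobi

instance isFiniteMeasure_restrict_Lam : IsFiniteMeasure (volume.restrict Lam) := by
  unfold Lam; infer_instance

lemma ae_restrict_Lam {P : ℝ → Prop} (h : ∀ x ∈ Lam, P x) : ∀ᵐ x ∂volume.restrict Lam, P x :=
  (ae_restrict_iff' measurableSet_Ioo).2 (Eventually.of_forall h)

lemma integrableOn_Lam_of_bound {f : ℝ → ℂ} {B : ℝ} (hf : ContinuousOn f Lam)
    (hB : ∀ x ∈ Lam, ‖f x‖ ≤ B) : IntegrableOn f Lam :=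
  Integrable.of_bound (hf.aestronglyMeasurable measurableSet_Ioo) B (ae_restrict_Lam hB)

lemma integrableOn_normSq_of_bound {f : ℝ → ℂ} {B : ℝ} (hf : ContinuousOn f Lam)
    (hB : ∀ x ∈ Lam, ‖f x‖ ≤ B) : IntegrableOn (fun x => ‖f x‖ ^ 2) Lam :=
  Integrable.of_bound ((hf.norm.pow 2).aestronglyMeasurable measurableSet_Ioo) (B ^ 2)
    (ae_restrict_Lam fun x hx => by
      rw [Real.norm_of_nonneg (by positivity)]
      exact pow_le_pow_left₀ (norm_nonneg _) (hB x hx) 2)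

/-- A weighted Nikolskii inequality. -/
theorem exists_sq_norm_eval_le {α : ℝ} (hα : 0 < α) : ∃ C : ℝ, 0 < C ∧ ∀ N : ℕ, 1 ≤ N →
    ∀ p : ℂ[X], p.natDegree ≤ N → ∀ x : ℝ, x ∈ Icc (-1 : ℝ) 1 →
      ‖p.eval (x : ℂ)‖ ^ 2 ≤ C * (N : ℝ) ^ (4 * α + 2) * normSq (weighted α p) := by
  refine ⟨4 * (4 * Real.exp 2) ^ (2 * α + 1), by positivity, fun N hN1 p hN x hx => ?_⟩
  obtain ⟨x₀, hx₀, hmax⟩ := exists_bound_eval p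
  have hN0 : (1 : ℝ) ≤ N := by exact_mod_cast hN1
  have hK : 1 ≤ Real.exp 2 := Real.one_le_exp (by norm_num)
  set S := ‖p.eval (x₀ : ℂ)‖ with hS
  have hS0 : 0 ≤ S := norm_nonneg _
  -- The derivative bound `e² N² S` lets `p` change by at most `S/2` over a distance `2h`. The final
  -- constant is `4 (h^{2α} h)⁻¹` without its power of `N`.
  set h : ℝ := 1 / (4 * Real.exp 2 * N ^ 2) with hh
  have hKN : 1 ≤ Real.exp 2 * N ^ 2 := one_le_mul_of_one_le_of_one_le hK (one_le_pow₀ hN0)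
  have hh0 : 0 < h := by positivity
  have hh1 : h ≤ 1 / 4 := by
    rw [hh]; apply one_div_le_one_div_of_le <;> nlinarith
  -- An interval of length `h` next to the maximum point, on the side of the origin: close enough
  -- for `|p| ≥ S/2`, yet at distance at least `h` from `±1`, so that the weight is at least `h^α`.
  obtain ⟨a, b, hab, hnear, hin⟩ : ∃ a b : ℝ, b = a + h ∧
      (∀ y ∈ Icc a b, |y - x₀| ≤ 2 * h) ∧ ∀ y ∈ Icc a b, |y| ≤ 1 - h := by
    rcases le_total 0 x₀ with h0 | h0
    · refine ⟨x₀ - 2 * h, x₀ - h, by ring, fun y hy => ?_, fun y hy => ?_⟩ <;>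
        rw [abs_le] <;> constructor <;> linarith [hy.1, hy.2, hx₀.1, hx₀.2]
    · refine ⟨x₀ + h, x₀ + 2 * h, by ring, fun y hy => ?_, fun y hy => ?_⟩ <;>
        rw [abs_le] <;> constructor <;> linarith [hy.1, hy.2, hx₀.1, hx₀.2]
  have hsub : Icc a b ⊆ Lam := fun y hy => by
    have := abs_le.1 (hin y hy)
    constructor <;> linarith
  have hlow : ∀ y ∈ Icc a b, h ^ (2 * α) * (S ^ 2 / 4) ≤ ‖weighted α p y‖ ^ 2 := by
    intro y hy
    rw [norm_weighted (hsub hy), mul_pow]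
    have h1 : S / 2 ≤ ‖p.eval (y : ℂ)‖ := by
      have h2 := norm_eval_sub_le hN hN1 hmax hx₀
        ⟨(hsub hy).1.le, (hsub hy).2.le⟩
      have h3 : Real.exp 2 * N ^ 2 * S * |y - x₀| ≤ S / 2 := by
        calc _ ≤ Real.exp 2 * N ^ 2 * S * (2 * h) := by gcongr; exact hnear y hy
          _ = S / 2 := by rw [hh]; field_simp; norm_num
      have h4 := norm_sub_norm_le (p.eval (x₀ : ℂ)) (p.eval (y : ℂ))
      rw [norm_sub_rev] at h4
      linarith
    have h2 : h ≤ 1 - y ^ 2 := by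
      have h3 := hin y hy
      have h4 := abs_nonneg y
      have : y ^ 2 ≤ |y| := by rw [← sq_abs]; nlinarith
      linarith
    have h5 : h ^ (2 * α) = (h ^ α) ^ 2 := by
      rw [← Real.rpow_natCast, ← Real.rpow_mul hh0.le]; congr 1; push_cast; ring
    rw [h5, show S ^ 2 / 4 = (S / 2) ^ 2 by ring]
    gcongr
  have hint : h * (h ^ (2 * α) * (S ^ 2 / 4)) ≤ normSq (weighted α p) := by
    have hi := integrableOn_normSq_of_bound ((contDiffOn_weighted α p (n := 0)).continuousOn)
      (fun x hx => norm_weighted_le hα hmax hx)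
    calc _ = ∫ y in Icc a b, h ^ (2 * α) * (S ^ 2 / 4) := by
          rw [setIntegral_const, hab, Real.volume_real_Icc_of_le (by linarith), smul_eq_mul]; ring
      _ ≤ ∫ y in Icc a b, ‖weighted α p y‖ ^ 2 :=
          setIntegral_mono_on continuousOn_const.integrableOn_Icc (hi.mono_set hsub) measurableSet_Icc hlow
      _ ≤ normSq (weighted α p) := setIntegral_mono_set hi
          (Eventually.of_forall fun _ => by positivity) (Eventually.of_forall hsub)
  have e1 : (4 * Real.exp 2) ^ (2 * α + 1) * (N : ℝ) ^ (4 * α + 2) = (h ^ (2 * α) * h)⁻¹ := by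
    have e2 : h = (4 * Real.exp 2 * N ^ 2)⁻¹ := by rw [hh, one_div]
    rw [← Real.rpow_add_one hh0.ne', e2, Real.inv_rpow (by positivity), inv_inv,
      Real.mul_rpow (by positivity) (y := (N : ℝ) ^ 2) (by positivity),
      ← Real.rpow_natCast (N : ℝ) 2, ← Real.rpow_mul (by positivity)]
    congr 2; push_cast; ring
  calc ‖p.eval (x : ℂ)‖ ^ 2 ≤ S ^ 2 := pow_le_pow_left₀ (norm_nonneg _) (hmax x hx) 2
    _ = 4 * (h ^ (2 * α) * h)⁻¹ * (h * (h ^ (2 * α) * (S ^ 2 / 4))) := by field_simp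
    _ ≤ 4 * (h ^ (2 * α) * h)⁻¹ * normSq (weighted α p) := by gcongr
    _ = _ := by rw [← e1]; ring

/-! ### Decay of the Fourier transform by a contour shift -/

/-- The analytic integrand whose integral over `[-1, 1]` is the Fourier transform. -/
def rayFun (α : ℝ) (p : ℂ[X]) (ξ : ℝ) (z : ℂ) : ℂ :=
  (1 - z ^ 2) ^ (α : ℂ) * p.eval z * Complex.exp (-(Complex.I * ξ * z))

/-- The number `1 - z²` meets the cut `(-∞, 0]` only for real `z` with `|z| ≥ 1`. Of these only `z =
±1` is allowed here; there the base vanishes and the power is continuous because `α > 0`. -/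
lemma continuousAt_one_sub_sq_cpow {α : ℝ} (hα : 0 < α) {z : ℂ}
    (hz : z.im ≠ 0 ∨ z.re ∈ Icc (-1 : ℝ) 1) :
    ContinuousAt (fun z : ℂ => (1 - z ^ 2) ^ (α : ℂ)) z := by
  by_cases h0 : 1 - z ^ 2 = 0
  · have h1 : ContinuousAt (fun p : ℂ × ℂ => p.1 ^ p.2) ((0 : ℂ), (α : ℂ)) :=
      Complex.continuousAt_cpow_zero_of_re_pos (by simpa using hα)
    rw [← h0] at h1
    exact ContinuousAt.comp (f := fun z : ℂ => (1 - z ^ 2, (α : ℂ))) h1 (by fun_prop)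
  · refine ContinuousAt.cpow (by fun_prop) continuousAt_const ?_
    rw [Complex.mem_slitPlane_iff]
    by_contra! hc
    obtain ⟨h1, h2⟩ := hc
    have e1 : (1 - z ^ 2).re = 1 - (z.re ^ 2 - z.im ^ 2) := by simp [pow_two]
    have e2 : (1 - z ^ 2).im = -(2 * z.re * z.im) := by simp [pow_two]; ring
    rw [e1] at h1
    rw [e2, neg_eq_zero] at h2
    rcases hz with hz | hz
    · have : z.re = 0 := by simpa [hz] using h2
      rw [this] at h1
      nlinarith [sq_nonneg z.im]
    · have h3 : z.re ^ 2 = 1 ∧ z.im = 0 := by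
        have h4 : z.re ^ 2 ≤ 1 := by nlinarith [hz.1, hz.2]
        have h5 : z.im ^ 2 = 0 := by nlinarith [sq_nonneg z.im]
        have h6 : z.im = 0 := by simpa using h5
        exact ⟨by rw [h6] at h1; nlinarith, h6⟩
      apply h0
      apply Complex.ext
      · rw [e1, h3.1, h3.2]; simp
      · rw [e2, h3.2]; simp

lemma differentiableAt_one_sub_sq_cpow {α : ℝ} {z : ℂ} (hz : z.im ≠ 0) :
    DifferentiableAt ℂ (fun z : ℂ => (1 - z ^ 2) ^ (α : ℂ)) z := by
  refine DifferentiableAt.cpow (by fun_prop) (by fun_prop) ?_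
  rw [Complex.mem_slitPlane_iff]
  by_contra! hc
  obtain ⟨h1, h2⟩ := hc
  have e1 : (1 - z ^ 2).re = 1 - (z.re ^ 2 - z.im ^ 2) := by simp [pow_two]
  have e2 : (1 - z ^ 2).im = -(2 * z.re * z.im) := by simp [pow_two]; ring
  rw [e1] at h1
  rw [e2, neg_eq_zero] at h2
  have : z.re = 0 := by simpa [hz] using h2
  rw [this] at h1
  nlinarith [sq_nonneg z.im]

lemma continuousOn_rayFun {α : ℝ} (hα : 0 < α) (p : ℂ[X]) (ξ Y : ℝ) :
    ContinuousOn (rayFun α p ξ) (uIcc (-1) 1 ×ℂ uIcc (-Y) 0) := by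
  intro z hz
  rw [uIcc_of_le (by norm_num)] at hz
  refine ContinuousAt.continuousWithinAt ?_
  unfold rayFun
  refine ((continuousAt_one_sub_sq_cpow hα (Or.inr hz.1)).mul p.continuous.continuousAt).mul ?_
  fun_prop

lemma differentiableOn_rayFun (α : ℝ) (p : ℂ[X]) (ξ Y : ℝ) :
    DifferentiableOn ℂ (rayFun α p ξ) (Ioo (-1) 1 ×ℂ Ioo (-Y) 0) := by
  intro z hz
  refine DifferentiableAt.differentiableWithinAt ?_
  unfold rayFun
  refine ((differentiableAt_one_sub_sq_cpow (hz.2.2).ne).mul p.differentiable.differentiableAt).mul ?_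
  fun_prop

/-- `rayFun` on the lower half plane, in terms of a bound of `1 - z ^ 2`. -/
lemma norm_rayFun_le {α : ℝ} (hα : 0 < α) {p : ℂ[X]} {N : ℕ} (hN : p.natDegree ≤ N) {S : ℝ}
    (hS : ∀ x : ℝ, x ∈ Icc (-1 : ℝ) 1 → ‖p.eval (x : ℂ)‖ ≤ S) {ξ : ℝ} {x y : ℝ}
    (hx : x ∈ Icc (-1 : ℝ) 1) (hy : 0 ≤ y) {B : ℝ}
    (hB : ‖1 - ((x : ℂ) + (-y : ℝ) * Complex.I) ^ 2‖ ≤ B) :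
    ‖rayFun α p ξ ((x : ℂ) + (-y : ℝ) * Complex.I)‖ ≤
      B ^ α * (S * Real.exp (2 * N * √y)) * Real.exp (-(ξ * y)) := by
  have hS0 : 0 ≤ S := (norm_nonneg _).trans (hS 0 (by constructor <;> norm_num))
  rw [rayFun, norm_mul, norm_mul, Complex.norm_exp]
  have e1 : (-(Complex.I * ξ * ((x : ℂ) + (-y : ℝ) * Complex.I))).re = -(ξ * y) := by
    simp
  have hn : ∀ c : ℝ, ‖(x : ℂ) + (-y : ℝ) * Complex.I - c‖ ≤ |x - c| + y := by
    intro c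
    calc _ = ‖((x - c : ℝ) : ℂ) + (-y : ℝ) * Complex.I‖ := by congr 1; push_cast; ring
      _ ≤ _ := by
        refine (norm_add_le _ _).trans ?_
        rw [norm_mul, Complex.norm_real, Complex.norm_real, Complex.norm_I, mul_one,
          Real.norm_eq_abs, Real.norm_eq_abs, abs_neg, abs_of_nonneg hy]
  rw [e1]
  gcongr
  · exact Real.rpow_nonneg ((norm_nonneg _).trans hB) _
  · by_cases h0 : 1 - ((x : ℂ) + (-y : ℝ) * Complex.I) ^ 2 = 0
    · rw [h0, Complex.zero_cpow (by exact_mod_cast hα.ne'), norm_zero]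
      exact Real.rpow_nonneg ((norm_nonneg _).trans hB) _
    · rw [Complex.norm_cpow_of_ne_zero h0]
      simp only [Complex.ofReal_re, Complex.ofReal_im, mul_zero, Real.exp_zero, div_one]
      gcongr
  · refine norm_eval_le_exp hN hS hy ?_
    have h1 := hn 1
    have h2 := hn (-1)
    push_cast at h1 h2 ⊢
    rw [sub_neg_eq_add] at h2
    rw [abs_of_nonpos (by linarith [hx.2])] at h1
    rw [abs_of_nonneg (by linarith [hx.1])] at h2
    linarith

/-- Half of the decay `e^{-t}` pays for `e^{2√t}`, since `2√t ≤ 2 + t/2`, and a quarter pays for the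
power. In the application `t = ξy`. -/
lemma exists_rpow_mul_exp_le (α : ℝ) (hα : 0 < α) :
    ∃ C : ℝ, 0 < C ∧ ∀ t : ℝ, 0 ≤ t → (t + 3) ^ α * Real.exp (2 * √t - t) ≤ C * Real.exp (-(t / 4)) := by
  have h1 : Tendsto (fun t : ℝ => t ^ α * Real.exp (-(1 / 4) * t)) atTop (𝓝 0) :=
    tendsto_rpow_mul_exp_neg_mul_atTop_nhds_zero α (1 / 4) (by norm_num)
  obtain ⟨T, hT⟩ := eventually_atTop.1 (h1.eventually (gt_mem_nhds zero_lt_one))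
  have hc : ContinuousOn (fun t : ℝ => t ^ α * Real.exp (-(1 / 4) * t)) (Icc 0 (max T 0)) := by
    apply Continuous.continuousOn
    exact (Real.continuous_rpow_const hα.le).mul (by fun_prop)
  obtain ⟨M, hM⟩ := isCompact_Icc.bddAbove_image hc
  have hb : ∀ t : ℝ, 0 ≤ t → t ^ α * Real.exp (-(1 / 4) * t) ≤ max M 1 := by
    intro t ht
    rcases le_total t (max T 0) with h | h
    · exact (hM ⟨t, ⟨ht, h⟩, rfl⟩).trans (le_max_left _ _)
    · exact (hT t ((le_max_left _ _).trans h)).le.trans (le_max_right _ _)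
  refine ⟨max M 1 * Real.exp (3 / 4) * Real.exp 2, by positivity, fun t ht => ?_⟩
  have h2 : 2 * √t - t ≤ 2 - t / 2 := by
    have := Real.sq_sqrt ht
    nlinarith [sq_nonneg (√t - 2)]
  calc (t + 3) ^ α * Real.exp (2 * √t - t) ≤ (t + 3) ^ α * Real.exp (2 - t / 2) := by gcongr
    _ = ((t + 3) ^ α * Real.exp (-(1 / 4) * (t + 3))) * Real.exp (3 / 4) * Real.exp 2 *
          Real.exp (-(t / 4)) := by
        simp only [mul_assoc, ← Real.exp_add]; congr 2; ring
    _ ≤ _ := by gcongr; exact hb _ (by linarith)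

/-- The condition `N² ≤ ξ` turns the growth exponent `2N√y` into `2√(ξy)`, which depends on `ξy`
only. The parameter `D` carries the size of the weight: `1/ξ` on the vertical sides of the contour,
`1` on the bottom side. -/
lemma exists_norm_rayFun_le {α : ℝ} (hα : 0 < α) : ∃ C : ℝ, 0 < C ∧ ∀ (p : ℂ[X]) (N : ℕ),
    p.natDegree ≤ N → ∀ S : ℝ, (∀ x : ℝ, x ∈ Icc (-1 : ℝ) 1 → ‖p.eval (x : ℂ)‖ ≤ S) →
    ∀ ξ x y D : ℝ, (N : ℝ) ^ 2 ≤ ξ → x ∈ Icc (-1 : ℝ) 1 → 0 ≤ y → 0 ≤ D →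
    ‖1 - ((x : ℂ) + (-y : ℝ) * Complex.I) ^ 2‖ ≤ (ξ * y + 3) ^ 2 * D →
    ‖rayFun α p ξ ((x : ℂ) + (-y : ℝ) * Complex.I)‖ ≤ C * S * D ^ α * Real.exp (-(ξ / 4 * y)) := by
  obtain ⟨C, hC, h⟩ := exists_rpow_mul_exp_le (2 * α) (by positivity)
  refine ⟨C, hC, fun p N hN S hS ξ x y D hξ hx hy hD hB => ?_⟩
  have hS0 : 0 ≤ S := (norm_nonneg _).trans (hS 0 (by constructor <;> norm_num))
  have hξ0 : 0 ≤ ξ := (sq_nonneg _).trans hξ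
  refine (norm_rayFun_le hα hN hS hx hy hB).trans ?_
  have h1 : (N : ℝ) * √y ≤ √(ξ * y) := by
    rw [Real.sqrt_mul hξ0]
    gcongr
    exact Real.le_sqrt_of_sq_le hξ
  have h2 : ((ξ * y + 3) ^ 2 * D) ^ α = (ξ * y + 3) ^ (2 * α) * D ^ α := by
    rw [Real.mul_rpow (by positivity) hD, ← Real.rpow_natCast, ← Real.rpow_mul (by positivity)]
    norm_num
  rw [h2]
  calc _ = S * D ^ α * ((ξ * y + 3) ^ (2 * α) * Real.exp (2 * (N * √y) - ξ * y)) := by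
        rw [sub_eq_add_neg, Real.exp_add]; ring_nf
    _ ≤ S * D ^ α * ((ξ * y + 3) ^ (2 * α) * Real.exp (2 * √(ξ * y) - ξ * y)) := by gcongr
    _ ≤ S * D ^ α * (C * Real.exp (-(ξ * y / 4))) := by
        exact mul_le_mul_of_nonneg_left (h _ (by positivity)) (by positivity)
    _ = _ := by ring_nf

lemma integral_exp_neg_le {c Y : ℝ} (hc : 0 < c) :
    ∫ y in (-Y)..0, Real.exp (-(c * -y)) ≤ 1 / c := by
  have : ∫ y in (-Y)..0, Real.exp (c * y) = (1 - Real.exp (-(c * Y))) / c := by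
    rw [intervalIntegral.integral_comp_mul_left (fun t => Real.exp t) hc.ne', integral_exp]
    simp; ring
  simp only [mul_neg, neg_neg]
  rw [this]
  gcongr
  linarith [Real.exp_pos (-(c * Y))]

/-- Decay of the Fourier transform of a weighted polynomial at high frequencies. -/
theorem exists_norm_integral_rayFun_le {α : ℝ} (hα : 0 < α) : ∃ C : ℝ, 0 < C ∧
    ∀ (p : ℂ[X]) (N : ℕ), 1 ≤ N → p.natDegree ≤ N → ∀ S : ℝ,
    (∀ x : ℝ, x ∈ Icc (-1 : ℝ) 1 → ‖p.eval (x : ℂ)‖ ≤ S) → ∀ ξ : ℝ, (N : ℝ) ^ 2 ≤ ξ →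
    ‖∫ x in (-1 : ℝ)..1, rayFun α p ξ (x : ℂ)‖ ≤ C * S * ξ ^ (-α - 1) := by
  obtain ⟨C, hC, h⟩ := exists_norm_rayFun_le hα
  refine ⟨8 * C, by positivity, fun p N hN1 hN S hS ξ hξ => ?_⟩
  have hS0 : 0 ≤ S := (norm_nonneg _).trans (hS 0 (by constructor <;> norm_num))
  have hξ1 : 1 ≤ ξ := le_trans (one_le_pow₀ (by exact_mod_cast hN1)) hξ
  have hξ0 : 0 < ξ := by linarith
  -- On the rays from `±1` one has `|1 - z²| = y |y ± 2i|`, hence the gain `ξ^{-α}`; integrating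
  -- `e^{-ξy/4}` gives the further factor `4/ξ`. The two rays together account for the constant `8 *
  -- C`.
  have hside : ∀ e : ℝ, e = 1 ∨ e = -1 → ∀ Y : ℝ, 0 < Y →
      ‖∫ y in (-Y)..0, rayFun α p ξ ((e : ℂ) + y * Complex.I)‖ ≤
        C * S * (1 / ξ) ^ α * (1 / (ξ / 4)) := by
    intro e he Y hY
    have h1 : ‖∫ y in (-Y)..0, rayFun α p ξ ((e : ℂ) + y * Complex.I)‖ ≤
        ∫ y in (-Y)..0, C * S * (1 / ξ) ^ α * Real.exp (-(ξ / 4 * -y)) := by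
      refine intervalIntegral.norm_integral_le_of_norm_le (by linarith) ?_
        (Continuous.intervalIntegrable (by fun_prop) _ _)
      refine Eventually.of_forall fun y hy => ?_
      have h2 := h p N hN S hS ξ e (-y) (1 / ξ) hξ (by rcases he with rfl | rfl <;> norm_num)
        (by linarith [hy.2]) (by positivity) ?_
      · rwa [neg_neg] at h2
      · rw [neg_neg]
        have hy0 : 0 ≤ -y := by linarith [hy.2]
        have e1 : 1 - ((e : ℂ) + y * Complex.I) ^ 2 = ((-y : ℝ) : ℂ) * ((-y : ℝ) + 2 * e * Complex.I) := by
          have : (e : ℂ) ^ 2 = 1 := by rcases he with rfl | rfl <;> norm_num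
          push_cast
          linear_combination -this - (y : ℂ) ^ 2 * Complex.I_sq
        have e2 : ‖((-y : ℝ) : ℂ) + 2 * e * Complex.I‖ ≤ -y + 2 := by
          refine (norm_add_le _ _).trans ?_
          rw [Complex.norm_real, Real.norm_of_nonneg hy0, norm_mul, norm_mul, Complex.norm_I,
            Complex.norm_real]
          rcases he with rfl | rfl <;> norm_num
        rw [e1, norm_mul, Complex.norm_real, Real.norm_of_nonneg hy0]
        have e3 : -y ≤ ξ * -y := by nlinarith
        calc -y * ‖((-y : ℝ) : ℂ) + 2 * e * Complex.I‖ ≤ -y * (ξ * -y + 2) := by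
              gcongr; linarith
          -- The added term completes the square.
          _ ≤ -y * (ξ * -y + 2) + (9 + 4 * (ξ * -y)) / ξ := by
              have : 0 ≤ (9 + 4 * (ξ * -y)) / ξ := by positivity
              linarith
          _ = (ξ * -y + 3) ^ 2 * (1 / ξ) := by field_simp; ring
    refine h1.trans ?_
    rw [intervalIntegral.integral_const_mul]
    gcongr
    exact integral_exp_neg_le (by positivity)
  have hbot : ∀ Y : ℝ, 0 < Y → ‖∫ x in (-1 : ℝ)..1, rayFun α p ξ ((x : ℂ) + (-Y : ℝ) * Complex.I)‖ ≤
      C * S * Real.exp (-(ξ / 4 * Y)) * 2 := by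
    intro Y hY
    have := intervalIntegral.norm_integral_le_of_norm_le_const (a := (-1 : ℝ)) (b := 1)
      (f := fun x : ℝ => rayFun α p ξ ((x : ℂ) + (-Y : ℝ) * Complex.I))
      (C := C * S * Real.exp (-(ξ / 4 * Y))) ?_
    · convert this using 2; norm_num
    · intro x hx
      rw [uIoc_of_le (by norm_num)] at hx
      have hx' : |x| ≤ 1 := abs_le.2 ⟨hx.1.le, hx.2⟩
      have h2 := h p N hN S hS ξ x Y 1 hξ ⟨hx.1.le, hx.2⟩ hY.le zero_le_one ?_
      · rwa [Real.one_rpow, mul_one] at h2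
      · have e1 : ‖(x : ℂ) + (-Y : ℝ) * Complex.I‖ ≤ 1 + Y := by
          refine (norm_add_le _ _).trans ?_
          rw [norm_mul, Complex.norm_real, Complex.norm_real, Complex.norm_I, mul_one,
            Real.norm_eq_abs, Real.norm_eq_abs, abs_neg, abs_of_pos hY]
          gcongr
        have e3 : Y ≤ ξ * Y := by nlinarith
        calc _ ≤ ‖(1 : ℂ)‖ + ‖(x : ℂ) + (-Y : ℝ) * Complex.I‖ ^ 2 := by
              rw [← norm_pow]; exact norm_sub_le _ _
          _ ≤ 1 + (1 + Y) ^ 2 := by rw [norm_one]; gcongr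
          _ ≤ 1 + (1 + ξ * Y) ^ 2 := by gcongr
          _ ≤ _ := by nlinarith
  have hY : ∀ Y : ℝ, 0 < Y → ‖∫ x in (-1 : ℝ)..1, rayFun α p ξ (x : ℂ)‖ ≤
      C * S * Real.exp (-(ξ / 4 * Y)) * 2 + 2 * (C * S * (1 / ξ) ^ α * (1 / (ξ / 4))) := by
    intro Y hY
    -- Cauchy's theorem on `[-1, 1] × [-Y, 0]`: continuity up to the boundary suffices, which
    -- matters because the integrand need not be holomorphic at `±1`. The bottom side disappears as
    -- `Y → ∞`.
    have hrect := Complex.integral_boundary_rect_eq_zero_of_continuousOn_of_differentiableOn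
      (rayFun α p ξ) ((-1 : ℝ) + (-Y : ℝ) * Complex.I) ((1 : ℝ) + (0 : ℝ) * Complex.I) ?_ ?_
    · simp only [Complex.add_re, Complex.ofReal_re, Complex.mul_re, Complex.I_re, mul_zero,
        Complex.ofReal_im, Complex.I_im, mul_one, sub_self, add_zero, Complex.add_im,
        Complex.mul_im, zero_add] at hrect
      simp only [Complex.ofReal_zero, zero_mul, add_zero] at hrect
      have e1 : ∫ x in (-1 : ℝ)..1, rayFun α p ξ (x : ℂ) =
          (∫ x in (-1 : ℝ)..1, rayFun α p ξ ((x : ℂ) + (-Y : ℝ) * Complex.I)) +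
          Complex.I • (∫ y in (-Y)..0, rayFun α p ξ (((1 : ℝ) : ℂ) + y * Complex.I)) -
          Complex.I • (∫ y in (-Y)..0, rayFun α p ξ (((-1 : ℝ) : ℂ) + y * Complex.I)) := by
        linear_combination -hrect
      rw [e1]
      refine (norm_sub_le _ _).trans ?_
      rw [norm_smul, Complex.norm_I, one_mul]
      have := norm_add_le
        (∫ x in (-1 : ℝ)..1, rayFun α p ξ ((x : ℂ) + (-Y : ℝ) * Complex.I))
        (Complex.I • (∫ y in (-Y)..0, rayFun α p ξ (((1 : ℝ) : ℂ) + y * Complex.I)))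
      rw [norm_smul, Complex.norm_I, one_mul] at this
      have h1 := hside 1 (Or.inl rfl) Y hY
      have h2 := hside (-1) (Or.inr rfl) Y hY
      have h3 := hbot Y hY
      linarith
    · simpa using continuousOn_rayFun hα p ξ Y
    · have := differentiableOn_rayFun α p ξ Y
      simpa [hY.le] using this
  have hlim : Tendsto (fun Y : ℝ => C * S * Real.exp (-(ξ / 4 * Y)) * 2 +
      2 * (C * S * (1 / ξ) ^ α * (1 / (ξ / 4)))) atTop
      (𝓝 (C * S * 0 * 2 + 2 * (C * S * (1 / ξ) ^ α * (1 / (ξ / 4))))) := by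
    have : Tendsto (fun Y : ℝ => Real.exp (-(ξ / 4 * Y))) atTop (𝓝 0) :=
      Real.tendsto_exp_neg_atTop_nhds_zero.comp
        (tendsto_id.const_mul_atTop (by positivity))
    exact ((this.const_mul _).mul_const _).add_const _
  refine (ge_of_tendsto hlim ((eventually_gt_atTop 0).mono hY)).trans (le_of_eq ?_)
  rw [Real.rpow_sub hξ0, Real.rpow_one, Real.rpow_neg hξ0.le, one_div, Real.inv_rpow hξ0.le]
  field_simp
  ring

/-- Polynomial reflection. -/
lemma weighted_neg (α : ℝ) (p : ℂ[X]) (x : ℝ) :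
    weighted α p (-x) = weighted α (p.comp (-Polynomial.X)) x := by
  simp [weighted]

lemma fourierExt_weighted (α : ℝ) (p : ℂ[X]) (ξ : ℝ) :
    fourierExt (weighted α p) ξ = ∫ x in (-1 : ℝ)..1, rayFun α p ξ (x : ℂ) := by
  rw [intervalIntegral.integral_of_le (by norm_num), integral_Ioc_eq_integral_Ioo]
  refine setIntegral_congr_fun measurableSet_Ioo fun x hx => ?_
  have h := one_sub_sq_pos hx
  simp only [rayFun, weighted]
  rw [Complex.ofReal_cpow h.le]
  push_cast
  ring

lemma integral_Lam_comp_neg (f : ℝ → ℂ) : ∫ x in Lam, f (-x) = ∫ x in Lam, f x := by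
  have e : ∀ g : ℝ → ℂ, ∫ x in Lam, g x = ∫ x in (-1 : ℝ)..1, g x := fun g => by
    rw [intervalIntegral.integral_of_le (by norm_num), integral_Ioc_eq_integral_Ioo]; rfl
  rw [e, e, intervalIntegral.integral_comp_neg]; simp

lemma fourierExt_neg (v : ℝ → ℂ) (ξ : ℝ) : fourierExt v (-ξ) = fourierExt (fun x => v (-x)) ξ := by
  rw [fourierExt, fourierExt, ← integral_Lam_comp_neg]
  congr 1; funext x; push_cast; ring_nf

/-- For `ξ < 0` the exponential decays in the upper half plane instead. Reflecting `x` reduces this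
to `ξ > 0`, since it preserves the weight, the degree bound and the bound `S`. -/
theorem exists_norm_fourierExt_le {α : ℝ} (hα : 0 < α) : ∃ C : ℝ, 0 < C ∧
    ∀ (p : ℂ[X]) (N : ℕ), 1 ≤ N → p.natDegree ≤ N → ∀ S : ℝ,
    (∀ x : ℝ, x ∈ Icc (-1 : ℝ) 1 → ‖p.eval (x : ℂ)‖ ≤ S) → ∀ ξ : ℝ, (N : ℝ) ^ 2 ≤ |ξ| →
    ‖fourierExt (weighted α p) ξ‖ ≤ C * S * |ξ| ^ (-α - 1) := by
  obtain ⟨C, hC, h⟩ := exists_norm_integral_rayFun_le hα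
  refine ⟨C, hC, fun p N hN1 hN S hS ξ hξ => ?_⟩
  rcases le_total 0 ξ with h0 | h0
  · rw [abs_of_nonneg h0] at hξ ⊢
    rw [fourierExt_weighted]
    exact h p N hN1 hN S hS ξ hξ
  · rw [abs_of_nonpos h0] at hξ ⊢
    rw [← neg_neg ξ, fourierExt_neg, neg_neg]
    simp only [weighted_neg]
    rw [fourierExt_weighted]
    refine h _ N hN1 ?_ S (fun x hx => ?_) (-ξ) hξ
    · refine Polynomial.natDegree_comp_le.trans ?_
      simpa using hN
    · have := hS (-x) ⟨by linarith [hx.2], by linarith [hx.1]⟩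
      simpa using this

end RieszJacobi
end

/-! ### Plancherel inequality and the seminorm estimate -/

noncomputable section
namespace RieszJacobi
open scoped FourierTransform ContDiff

/-- Fatou's lemma for square-integrable functions. -/
lemma integral_normSq_le_of_tendsto {μ : Measure ℝ} {f : ℕ → ℝ → ℂ} {g : ℝ → ℂ} {B : ℕ → ℝ}
    {b : ℝ} (hm : ∀ n, AEStronglyMeasurable (f n) μ)
    (hi : ∀ n, Integrable (fun x => ‖f n x‖ ^ 2) μ) (hB : ∀ n, ∫ x, ‖f n x‖ ^ 2 ∂μ ≤ B n)
    (hlim : ∀ᵐ x ∂μ, Tendsto (fun n => f n x) atTop (𝓝 (g x))) (hb : Tendsto B atTop (𝓝 b)) :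
    Integrable (fun x => ‖g x‖ ^ 2) μ ∧ ∫ x, ‖g x‖ ^ 2 ∂μ ≤ b := by
  have hg : AEStronglyMeasurable g μ := aestronglyMeasurable_of_tendsto_ae atTop hm hlim
  have hb0 : 0 ≤ b := ge_of_tendsto' hb fun n =>
    (integral_nonneg fun x => by positivity).trans (hB n)
  have key : ∫⁻ x, ENNReal.ofReal (‖g x‖ ^ 2) ∂μ ≤ ENNReal.ofReal b := by
    calc ∫⁻ x, ENNReal.ofReal (‖g x‖ ^ 2) ∂μ
        = ∫⁻ x, liminf (fun n => ENNReal.ofReal (‖f n x‖ ^ 2)) atTop ∂μ := by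
          refine lintegral_congr_ae (hlim.mono fun x hx => ?_)
          exact ((ENNReal.tendsto_ofReal ((hx.norm).pow 2)).liminf_eq).symm
      _ ≤ liminf (fun n => ∫⁻ x, ENNReal.ofReal (‖f n x‖ ^ 2) ∂μ) atTop :=
          lintegral_liminf_le' fun n => ((hm n).norm.aemeasurable.pow_const 2).ennreal_ofReal
      _ ≤ liminf (fun n => ENNReal.ofReal (B n)) atTop := by
          refine liminf_le_liminf (Eventually.of_forall fun n => ?_)
          rw [← ofReal_integral_eq_lintegral_ofReal (hi n)
            (Eventually.of_forall fun x => by positivity)]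
          exact ENNReal.ofReal_le_ofReal (hB n)
      _ = ENNReal.ofReal b := (ENNReal.tendsto_ofReal hb).liminf_eq
  have hint : Integrable (fun x => ‖g x‖ ^ 2) μ := by
    refine ⟨hg.norm.pow 2, ?_⟩
    rw [hasFiniteIntegral_iff_ofReal (Eventually.of_forall fun x => by positivity)]
    exact key.trans_lt ENNReal.ofReal_lt_top
  refine ⟨hint, ?_⟩
  rw [← ofReal_integral_eq_lintegral_ofReal hint (Eventually.of_forall fun x => by positivity)]
    at key
  exact (ENNReal.ofReal_le_ofReal_iff hb0).1 key

lemma isOpen_Lam : IsOpen Lam := isOpen_Ioo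

/-- The product of a smooth function supported in `Λ` and a function smooth on `Λ`. -/
lemma contDiff_mul_of_tsupport {φ u : ℝ → ℂ} (hφ : ContDiff ℝ ∞ φ) (hs : tsupport φ ⊆ Lam)
    (hu : ContDiffOn ℝ ∞ u Lam) : ContDiff ℝ ∞ (fun x => φ x * u x) := by
  rw [contDiff_iff_contDiffAt]
  intro x
  by_cases hx : x ∈ tsupport φ
  · exact hφ.contDiffAt.mul (hu.contDiffAt (isOpen_Lam.mem_nhds (hs hx)))
  · have : (fun x => φ x * u x) =ᶠ[𝓝 x] fun _ => 0 := by
      filter_upwards [(isClosed_tsupport φ).isOpen_compl.mem_nhds hx] with y hy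
      rw [image_eq_zero_of_notMem_tsupport hy]; simp
    exact contDiffAt_const.congr_of_eventuallyEq this

lemma tsupport_ofReal_subset (χ : ℝ → ℝ) : tsupport (fun x => (χ x : ℂ)) ⊆ tsupport χ :=
  tsupport_comp_subset Complex.ofReal_zero χ

lemma contDiff_cutoff_mul {χ : ℝ → ℝ} {u : ℝ → ℂ} (hχ : ContDiff ℝ ∞ χ) (hs : tsupport χ ⊆ Lam)
    (hu : ContDiffOn ℝ ∞ u Lam) : ContDiff ℝ ∞ (fun x => (χ x : ℂ) * u x) :=
  contDiff_mul_of_tsupport (Complex.ofRealCLM.contDiff.comp hχ)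
    ((tsupport_ofReal_subset χ).trans hs) hu

lemma tsupport_cutoff_mul_subset (χ : ℝ → ℝ) (u : ℝ → ℂ) :
    tsupport (fun x => (χ x : ℂ) * u x) ⊆ tsupport χ :=
  closure_mono fun x hx => by
    rw [Function.mem_support] at hx ⊢
    intro h; apply hx; simp [h]

lemma hasCompactSupport_of_tsupport_subset_Lam {E : Type*} [Zero E] {f : ℝ → E}
    (h : tsupport f ⊆ Lam) : HasCompactSupport f :=
  (isCompact_Icc (a := (-1 : ℝ)) (b := 1)).of_isClosed_subset (isClosed_tsupport f)
    (h.trans Ioo_subset_Icc_self)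

/-- Smooth cutoffs exhausting `Λ`. -/
lemma exists_cutoff : ∃ χ : ℕ → ℝ → ℝ, (∀ n, ContDiff ℝ ∞ (χ n)) ∧ (∀ n, tsupport (χ n) ⊆ Lam) ∧
    (∀ n x, χ n x ∈ Icc (0 : ℝ) 1) ∧ ∀ x ∈ Lam, ∀ᶠ n in atTop, χ n x = 1 := by
  have h0 : ∀ n : ℕ, (0 : ℝ) < 1 - 1 / (n + 2) := fun n => by
    rw [sub_pos, div_lt_one (by positivity)]; linarith [(Nat.cast_nonneg n : (0 : ℝ) ≤ n)]
  have h1 : ∀ n : ℕ, (1 : ℝ) - 1 / (n + 2) < 1 - 1 / (n + 3) := fun n => by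
    gcongr; norm_num
  let b : ℕ → ContDiffBump (0 : ℝ) := fun n => ⟨1 - 1 / (n + 2), 1 - 1 / (n + 3), h0 n, h1 n⟩
  refine ⟨fun n => b n, fun n => (b n).contDiff, fun n => ?_,
    fun n x => ⟨(b n).nonneg, (b n).le_one⟩, fun x hx => ?_⟩
  · rw [(b n).tsupport_eq, Real.closedBall_eq_Icc]
    have : (0 : ℝ) < 1 / ((n : ℝ) + 3) := by positivity
    intro x hx
    simp only [b, zero_sub, zero_add, mem_Icc] at hx
    constructor <;> linarith [hx.1, hx.2]
  · have ht : Tendsto (fun n : ℕ => (1 : ℝ) - 1 / (n + 2)) atTop (𝓝 (1 - 0)) := by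
      refine tendsto_const_nhds.sub ?_
      have := tendsto_one_div_add_atTop_nhds_zero_nat (𝕜 := ℝ)
      have := (tendsto_add_atTop_iff_nat 1).2 this
      refine this.congr fun n => ?_
      push_cast; ring
    rw [sub_zero] at ht
    have hx' : |x| < 1 := abs_lt.2 hx
    filter_upwards [ht.eventually (lt_mem_nhds hx')] with n hn
    refine (b n).one_of_mem_closedBall ?_
    rw [mem_closedBall_zero_iff, Real.norm_eq_abs]
    exact hn.le

lemma fourierExt_two_pi_mul {f : ℝ → ℂ} (hf : tsupport f ⊆ Lam) (w : ℝ) :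
    fourierExt f (2 * Real.pi * w) = 𝓕 f w := by
  rw [fourierExt, Real.fourier_real_eq_integral_exp_smul, setIntegral_eq_integral_of_forall_compl_eq_zero]
  · congr 1; funext x
    rw [smul_eq_mul]; congr 2; push_cast; ring
  · intro x hx
    rw [image_eq_zero_of_notMem_tsupport fun h => hx (hf h), mul_zero]

lemma norm_fourier_kernel (ξ x : ℝ) : ‖Complex.exp (-(Complex.I * ξ * x))‖ = 1 := by
  rw [show -(Complex.I * ξ * x) = ((-(ξ * x) : ℝ) : ℂ) * Complex.I by push_cast; ring,
    Complex.norm_exp_ofReal_mul_I]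

lemma continuous_fourierExt {u : ℝ → ℂ} (hu : IntegrableOn u Lam) : Continuous (fourierExt u) := by
  refine continuous_of_dominated (bound := fun x => ‖u x‖) (fun ξ => ?_) (fun ξ => ?_) hu.norm ?_
  · exact (Continuous.aestronglyMeasurable (by fun_prop)).mul hu.aestronglyMeasurable
  · exact Eventually.of_forall fun x => by rw [norm_mul, norm_fourier_kernel, one_mul]
  · exact Eventually.of_forall fun x => by fun_prop

lemma fourierExt_tendsto_of_cutoff {u : ℝ → ℂ} (hu : IntegrableOn u Lam) {χ : ℕ → ℝ → ℝ}
    (hχ : ∀ n, Continuous (χ n)) (h01 : ∀ n x, χ n x ∈ Icc (0 : ℝ) 1)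
    (h1 : ∀ x ∈ Lam, ∀ᶠ n in atTop, χ n x = 1) (ξ : ℝ) :
    Tendsto (fun n => fourierExt (fun x => (χ n x : ℂ) * u x) ξ) atTop (𝓝 (fourierExt u ξ)) := by
  refine tendsto_integral_of_dominated_convergence (fun x => ‖u x‖) (fun n => ?_) hu.norm
    (fun n => ?_) ?_
  · exact (Continuous.aestronglyMeasurable (by fun_prop)).mul
      ((Complex.continuous_ofReal.comp (hχ n)).aestronglyMeasurable.mul hu.aestronglyMeasurable)
  · refine Eventually.of_forall fun x => ?_
    rw [norm_mul, norm_fourier_kernel, one_mul, norm_mul, Complex.norm_real,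
      Real.norm_of_nonneg (h01 n x).1]
    exact mul_le_of_le_one_left (norm_nonneg _) (h01 n x).2
  · refine ae_restrict_Lam fun x hx => ?_
    refine tendsto_const_nhds.congr' ?_
    filter_upwards [h1 x hx] with n hn
    rw [hn]; simp

/-- The Plancherel inequality for the zero extension of a bounded smooth function on `Λ`. -/
theorem integral_normSq_fourierExt_le {u : ℝ → ℂ} {B : ℝ} (hu : ContDiffOn ℝ ∞ u Lam)
    (hB : ∀ x ∈ Lam, ‖u x‖ ≤ B) : Integrable (fun ξ => ‖fourierExt u ξ‖ ^ 2) ∧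
      ∫ ξ, ‖fourierExt u ξ‖ ^ 2 ≤ 2 * Real.pi * normSq u := by
  obtain ⟨χ, hχ, hs, h01, h1⟩ := exists_cutoff
  have hui := integrableOn_Lam_of_bound hu.continuousOn hB
  have hui2 := integrableOn_normSq_of_bound hu.continuousOn hB
  -- The cut-off functions are Schwartz functions, for which Plancherel is an equality, and `|φ n| ≤
  -- |u|`. Fatou's lemma then keeps the inequality in the limit; the factor `2π` comes from `ξ =
  -- 2πw`.
  let φ : ℕ → ℝ → ℂ := fun n x => (χ n x : ℂ) * u x
  have hφs : ∀ n, tsupport (φ n) ⊆ Lam := fun n => (tsupport_cutoff_mul_subset _ _).trans (hs n)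
  let f : ℕ → SchwartzMap ℝ ℂ := fun n =>
    (hasCompactSupport_of_tsupport_subset_Lam (hφs n)).toSchwartzMap
      (contDiff_cutoff_mul (hχ n) (hs n) hu)
  have hfφ : ∀ n ξ, fourierExt (φ n) ξ = (𝓕 (f n)) (ξ / (2 * Real.pi)) := by
    intro n ξ
    rw [SchwartzMap.fourier_coe]
    conv_lhs => rw [show ξ = 2 * Real.pi * (ξ / (2 * Real.pi)) by field_simp]
    exact fourierExt_two_pi_mul (hφs n) _
  refine integral_normSq_le_of_tendsto (f := fun n => fourierExt (φ n))
    (B := fun _ => 2 * Real.pi * normSq u) (fun n => ?_) (fun n => ?_) (fun n => ?_)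
    (Eventually.of_forall fun ξ => fourierExt_tendsto_of_cutoff hui (fun n => (hχ n).continuous)
      h01 h1 ξ) tendsto_const_nhds
  · have : fourierExt (φ n) = fun ξ => (𝓕 (f n)) (ξ / (2 * Real.pi)) := funext (hfφ n)
    rw [this]
    exact ((𝓕 (f n)).continuous.comp (by fun_prop)).aestronglyMeasurable
  · simp only [hfφ]
    have : Integrable (fun w => ‖(𝓕 (f n)) w‖ ^ 2) :=
      (memLp_two_iff_integrable_sq_norm (𝓕 (f n)).continuous.aestronglyMeasurable).1
        ((𝓕 (f n)).memLp 2 volume)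
    exact this.comp_div (by positivity)
  · simp only [hfφ]
    have e := Measure.integral_comp_div (fun w : ℝ => ‖(𝓕 (f n)) w‖ ^ 2) (2 * Real.pi)
    rw [SchwartzMap.integral_norm_sq_fourier, abs_of_pos (by positivity), smul_eq_mul] at e
    refine e.le.trans ?_
    gcongr
    have : ∫ x, ‖(f n) x‖ ^ 2 = ∫ x in Lam, ‖φ n x‖ ^ 2 := by
      rw [setIntegral_eq_integral_of_forall_compl_eq_zero]
      · rfl
      · intro x hx
        rw [image_eq_zero_of_notMem_tsupport fun h => hx (hφs n h)]; simp
    rw [this]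
    refine integral_mono_of_nonneg (Eventually.of_forall fun x => by positivity) hui2
      (Eventually.of_forall fun x => ?_)
    simp only [φ]
    rw [norm_mul, Complex.norm_real, Real.norm_of_nonneg (h01 n x).1]
    exact pow_le_pow_left₀ (mul_nonneg (h01 n x).1 (norm_nonneg _))
      (mul_le_of_le_one_left (norm_nonneg (u x)) (h01 n x).2) 2

/-- The tail of a power, as a function on the line. -/
def powTail (M q : ℝ) (ξ : ℝ) : ℝ := indicator (Ioi M) (fun t => t ^ (-q)) |ξ|

lemma powTail_nonneg {M : ℝ} (hM : 0 < M) (q ξ : ℝ) : 0 ≤ powTail M q ξ :=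
  indicator_nonneg (fun _ ht => Real.rpow_nonneg (hM.le.trans (le_of_lt ht)) _) _

lemma integral_powTail {M q : ℝ} (hM : 0 < M) (hq : 1 < q) :
    ∫ ξ, powTail M q ξ = 2 * (M ^ (1 - q) / (q - 1)) := by
  unfold powTail
  rw [integral_comp_abs (f := indicator (Ioi M) (fun t => t ^ (-q))), setIntegral_indicator
    measurableSet_Ioi, Ioi_inter_Ioi, max_eq_right hM.le, integral_Ioi_rpow_of_lt (by linarith) hM]
  congr 1
  rw [show -q + 1 = 1 - q by ring, ← neg_sub q 1, div_neg, neg_div, neg_neg]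

/-- A non-integrable function has integral `0` by convention, whereas the computed value is
positive. -/
lemma integrable_powTail {M q : ℝ} (hM : 0 < M) (hq : 1 < q) : Integrable (powTail M q) := by
  by_contra h
  have h1 := integral_undef h
  rw [integral_powTail hM hq] at h1
  have : 0 < 2 * (M ^ (1 - q) / (q - 1)) := by
    have := Real.rpow_pos_of_pos hM (1 - q)
    have : 0 < q - 1 := by linarith
    positivity
  linarith

/-- Split at `|ξ| = M`: below, the multiplier is at most `M^{2r}`; above, the decay hypothesis
leaves the exponent `2r - 2α - 2`. -/
lemma pow_mul_normSq_le {α D M r : ℝ} (hM : 1 ≤ M) {F : ℝ → ℂ} (hr : 0 ≤ r)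
    (hF : ∀ ξ, M ≤ |ξ| → ‖F ξ‖ ≤ D * |ξ| ^ (-α - 1)) (ξ : ℝ) :
    |ξ| ^ (2 * r) * ‖F ξ‖ ^ 2 ≤
      M ^ (2 * r) * ‖F ξ‖ ^ 2 + D ^ 2 * powTail M (2 * α + 2 - 2 * r) ξ := by
  have hM0 : 0 < M := by linarith
  rcases le_or_gt |ξ| M with h | h
  · have h1 := powTail_nonneg hM0 (2 * α + 2 - 2 * r) ξ
    have h2 : |ξ| ^ (2 * r) ≤ M ^ (2 * r) := Real.rpow_le_rpow (abs_nonneg _) h (by positivity)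
    nlinarith [mul_le_mul_of_nonneg_right h2 (sq_nonneg ‖F ξ‖), mul_nonneg (sq_nonneg D) h1]
  · have h0 : 0 < |ξ| := hM0.trans h
    have h1 : 0 ≤ M ^ (2 * r) * ‖F ξ‖ ^ 2 := by positivity
    have h2 : powTail M (2 * α + 2 - 2 * r) ξ = |ξ| ^ (2 * r) * (|ξ| ^ (-α - 1)) ^ 2 := by
      rw [powTail, indicator_of_mem (mem_Ioi.2 h), ← Real.rpow_natCast (|ξ| ^ (-α - 1)) 2,
        ← Real.rpow_mul h0.le, ← Real.rpow_add h0]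
      congr 1; push_cast; ring
    calc _ ≤ |ξ| ^ (2 * r) * (D * |ξ| ^ (-α - 1)) ^ 2 := by
          gcongr; exact hF ξ h.le
      _ = D ^ 2 * powTail M (2 * α + 2 - 2 * r) ξ := by rw [h2]; ring
      _ ≤ _ := by linarith

/-- The condition `2r < 2α + 1` makes the tail exponent integrable. It leaves room above `r = α`,
which the limit defining the derivative of odd order needs. -/
lemma integrable_pow_mul_normSq {α D M r : ℝ} (hM : 1 ≤ M) {F : ℝ → ℂ} (hr : 0 ≤ r)
    (hrα : 2 * r < 2 * α + 1) (hc : Continuous F) (hi : Integrable (fun ξ => ‖F ξ‖ ^ 2))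
    (hF : ∀ ξ, M ≤ |ξ| → ‖F ξ‖ ≤ D * |ξ| ^ (-α - 1)) :
    Integrable (fun ξ => |ξ| ^ (2 * r) * ‖F ξ‖ ^ 2) := by
  refine ((hi.const_mul (M ^ (2 * r))).add ((integrable_powTail (M := M) (by linarith)
    (q := 2 * α + 2 - 2 * r) (by linarith)).const_mul (D ^ 2))).mono' ?_ ?_
  · exact ((continuous_abs.rpow_const fun _ => Or.inr (by positivity)).mul
      (hc.norm.pow 2)).aestronglyMeasurable
  · refine Eventually.of_forall fun ξ => ?_
    rw [Real.norm_of_nonneg (by positivity)]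
    exact pow_mul_normSq_le hM hr hF ξ

lemma two_pi_mul_seminormSq (s : ℝ) (v : ℝ → ℂ) :
    2 * Real.pi * seminormSq s v = ∫ ξ : ℝ, |ξ| ^ (2 * s) * ‖fourierExt v ξ‖ ^ 2 := by
  rw [seminormSq]; field_simp

/-- The inverse inequality for the seminorm on the line, with a decay bound
of the Fourier transform. -/
theorem exists_seminormSq_le {α : ℝ} (hα : 0 < α) : ∃ C : ℝ, 0 < C ∧
    ∀ N : ℕ, 1 ≤ N → ∀ p : ℂ[X], p.natDegree ≤ N →
      (∃ D : ℝ, 0 ≤ D ∧ ∀ ξ : ℝ, (N : ℝ) ^ 2 ≤ |ξ| →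
        ‖fourierExt (weighted α p) ξ‖ ≤ D * |ξ| ^ (-α - 1)) ∧
      seminormSq α (weighted α p) ≤ C * (N : ℝ) ^ (4 * α) * normSq (weighted α p) := by
  obtain ⟨C₁, hC₁, h1⟩ := exists_norm_fourierExt_le hα
  obtain ⟨C₂, hC₂, h2⟩ := exists_sq_norm_eval_le hα
  refine ⟨1 + C₁ ^ 2 * C₂ / Real.pi, by positivity, fun N hN1 p hN => ?_⟩
  obtain ⟨x₀, hx₀, hmax⟩ := exists_bound_eval p
  set S := ‖p.eval (x₀ : ℂ)‖
  set u := weighted α p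
  have hN0 : (1 : ℝ) ≤ N := by exact_mod_cast hN1
  have hdec := h1 p N hN1 hN S hmax
  refine ⟨⟨C₁ * S, by positivity, hdec⟩, ?_⟩
  have hM : (1 : ℝ) ≤ (N : ℝ) ^ 2 := one_le_pow₀ hN0
  have hsm : ContDiffOn ℝ ∞ u Lam := contDiffOn_weighted α p
  have hbd : ∀ x ∈ Lam, ‖u x‖ ≤ S := fun x hx => norm_weighted_le hα hmax hx
  obtain ⟨hi, hpl⟩ := integral_normSq_fourierExt_le hsm hbd
  have hcont := continuous_fourierExt (integrableOn_Lam_of_bound hsm.continuousOn hbd)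
  have hS2 : S ^ 2 ≤ C₂ * (N : ℝ) ^ (4 * α + 2) * normSq u := h2 N hN1 p hN x₀ hx₀
  have htail := integrable_powTail (M := (N : ℝ) ^ 2) (q := 2) (by positivity) (by norm_num)
  -- The split is at `M = N²`. For `r = α` the tail exponent is `2`, with integral `2 N^{-2}`, and
  -- `S² ≤ C₂ N^{4α+2} ‖u‖²` restores `N^{4α}`. Dividing by `2π` gives the stated constant.
  have key : 2 * Real.pi * seminormSq α u ≤
      ((N : ℝ) ^ 2) ^ (2 * α) * (2 * Real.pi * normSq u) +
        (C₁ * S) ^ 2 * (2 * (((N : ℝ) ^ 2) ^ (-1 : ℝ))) := by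
    rw [two_pi_mul_seminormSq]
    calc _ ≤ ∫ ξ, (((N : ℝ) ^ 2) ^ (2 * α) * ‖fourierExt u ξ‖ ^ 2 +
            (C₁ * S) ^ 2 * powTail ((N : ℝ) ^ 2) 2 ξ) := by
          refine integral_mono (integrable_pow_mul_normSq hM hα.le (by linarith) hcont hi
            hdec) ((hi.const_mul _).add (htail.const_mul _)) fun ξ => ?_
          have := pow_mul_normSq_le (α := α) hM hα.le hdec ξ
          rwa [show 2 * α + 2 - 2 * α = 2 by ring] at this
      _ = ((N : ℝ) ^ 2) ^ (2 * α) * (∫ ξ, ‖fourierExt u ξ‖ ^ 2) +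
            (C₁ * S) ^ 2 * (2 * (((N : ℝ) ^ 2) ^ (-1 : ℝ))) := by
          rw [integral_add (hi.const_mul _) (htail.const_mul _), integral_const_mul,
            integral_const_mul, integral_powTail (by positivity) (by norm_num)]
          norm_num
      _ ≤ _ := by gcongr
  have e1 : ((N : ℝ) ^ 2) ^ (2 * α) = (N : ℝ) ^ (4 * α) := by
    rw [← Real.rpow_natCast, ← Real.rpow_mul (by positivity)]; congr 1; push_cast; ring
  have e2 : ((N : ℝ) ^ 2) ^ (-1 : ℝ) * (N : ℝ) ^ (4 * α + 2) = (N : ℝ) ^ (4 * α) := by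
    rw [← Real.rpow_natCast, ← Real.rpow_mul (by positivity), ← Real.rpow_add (by positivity)]
    congr 1; push_cast; ring
  have h3 : (C₁ * S) ^ 2 * (2 * (((N : ℝ) ^ 2) ^ (-1 : ℝ))) ≤
      2 * C₁ ^ 2 * C₂ * (N : ℝ) ^ (4 * α) * normSq u := by
    calc _ = 2 * C₁ ^ 2 * ((N : ℝ) ^ 2) ^ (-1 : ℝ) * S ^ 2 := by ring
      _ ≤ 2 * C₁ ^ 2 * ((N : ℝ) ^ 2) ^ (-1 : ℝ) * (C₂ * (N : ℝ) ^ (4 * α + 2) * normSq u) := by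
        gcongr
      _ = 2 * C₁ ^ 2 * C₂ * (((N : ℝ) ^ 2) ^ (-1 : ℝ) * (N : ℝ) ^ (4 * α + 2)) * normSq u := by ring
      _ = _ := by rw [e2]
  rw [e1] at key
  have hpi := Real.pi_pos
  have h4 : 2 * Real.pi * seminormSq α u ≤ 2 * Real.pi *
      ((1 + C₁ ^ 2 * C₂ / Real.pi) * (N : ℝ) ^ (4 * α) * normSq u) := by
    refine (key.trans (add_le_add_right h3 _)).trans (le_of_eq ?_)
    field_simp
  exact le_of_mul_le_mul_left h4 (by positivity)

end RieszJacobi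
end

/-! ### Smoothness of fractional integrals inside the interval -/

noncomputable section
namespace RieszJacobi
open scoped ContDiff

lemma tsupport_iteratedDeriv_subset (f : ℝ → ℂ) (k : ℕ) :
    tsupport (iteratedDeriv k f) ⊆ tsupport f := by
  induction k with
  | zero => simp
  | succ k ih => rw [iteratedDeriv_succ]; exact (tsupport_deriv_subset (𝕜 := ℝ)).trans ih

lemma contDiff_iteratedDeriv {f : ℝ → ℂ} (hf : ContDiff ℝ ∞ f) (k : ℕ) :
    ContDiff ℝ ∞ (iteratedDeriv k f) := by
  induction k with
  | zero => simpa using hf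
  | succ k ih => rw [iteratedDeriv_succ]; exact (contDiff_infty_iff_deriv.1 ih).2

lemma hasCompactSupport_iteratedDeriv {f : ℝ → ℂ} (hf : HasCompactSupport f) (k : ℕ) :
    HasCompactSupport (iteratedDeriv k f) :=
  hf.of_isClosed_subset (isClosed_tsupport _) (tsupport_iteratedDeriv_subset f k)

/-- A function that starts a sequence of successive derivatives on an open set. -/
lemma iteratedDeriv_eq_of_hasDerivAt {F : ℕ → ℝ → ℂ} {f : ℝ → ℂ} {U : Set ℝ} (hU : IsOpen U)
    (hf : EqOn f (F 0) U) (h : ∀ j, ∀ x ∈ U, HasDerivAt (F j) (F (j + 1) x) x) (k : ℕ) :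
    EqOn (iteratedDeriv k f) (F k) U := by
  induction k with
  | zero => simpa using hf
  | succ k ih =>
    intro x hx
    rw [iteratedDeriv_succ, (ih.eventuallyEq_of_mem (hU.mem_nhds hx)).deriv_eq]
    exact (h k x hx).deriv

lemma contDiffOn_of_hasDerivAt {F : ℕ → ℝ → ℂ} {f : ℝ → ℂ} {U : Set ℝ} (hU : IsOpen U)
    (hf : EqOn f (F 0) U) (h : ∀ j, ∀ x ∈ U, HasDerivAt (F j) (F (j + 1) x) x) :
    ContDiffOn ℝ ∞ f U := by
  have key : ∀ n : ℕ, ∀ j, ContDiffOn ℝ n (F j) U := by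
    intro n
    induction n with
    | zero =>
      intro j
      exact contDiffOn_zero.2 fun x hx => (h j x hx).continuousAt.continuousWithinAt
    | succ n ih =>
      intro j
      push_cast
      refine (contDiffOn_succ_iff_deriv_of_isOpen hU).2
        ⟨fun x hx => (h j x hx).differentiableAt.differentiableWithinAt, by simp, ?_⟩
      exact (ih (j + 1)).congr fun x hx => (h j x hx).deriv
  exact (contDiffOn_infty.2 fun n => key n 0).congr hf

/-- The fractional integral of order `ρ` from `-∞`. -/
def lineInt (ρ : ℝ) (f : ℝ → ℂ) (x : ℝ) : ℂ :=
  (((Real.Gamma ρ)⁻¹ : ℝ) : ℂ) * ∫ s in Ioi (0 : ℝ), ((s ^ (ρ - 1) : ℝ) : ℂ) * f (x - s)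

lemma locallyIntegrable_rpow_indicator {ρ : ℝ} (hρ : 0 < ρ) :
    LocallyIntegrable (indicator (Ioi (0 : ℝ)) fun s => s ^ (ρ - 1)) := by
  rw [locallyIntegrable_iff]
  intro k hk
  obtain ⟨R, hR⟩ := hk.isBounded.subset_closedBall 0
  refine IntegrableOn.mono_set ?_ hR
  rw [Real.closedBall_eq_Icc, integrableOn_Icc_iff_integrableOn_Ioc, zero_sub, zero_add]
  have h : IntegrableOn (fun s : ℝ => s ^ (ρ - 1)) (Ioc (-R) R) :=
    (intervalIntegral.intervalIntegrable_rpow' (a := -R) (b := R) (by linarith)).1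
  exact h.indicator measurableSet_Ioi

lemma lineInt_eq_convolution (ρ : ℝ) (f : ℝ → ℂ) (x : ℝ) :
    lineInt ρ f x = (((Real.Gamma ρ)⁻¹ : ℝ) : ℂ) *
      (convolution (indicator (Ioi (0 : ℝ)) fun s => s ^ (ρ - 1)) f
        (ContinuousLinearMap.lsmul ℝ ℝ) volume) x := by
  rw [lineInt, convolution, ← integral_indicator measurableSet_Ioi]
  congr 2; funext s
  by_cases hs : s ∈ Ioi (0 : ℝ) <;> simp [hs]

lemma hasDerivAt_lineInt {ρ : ℝ} (hρ : 0 < ρ) {f : ℝ → ℂ} (hf : ContDiff ℝ ∞ f)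
    (hc : HasCompactSupport f) (x : ℝ) : HasDerivAt (lineInt ρ f) (lineInt ρ (deriv f) x) x := by
  rw [lineInt_eq_convolution, funext (lineInt_eq_convolution ρ f)]
  exact (hc.hasDerivAt_convolution_right _ (locallyIntegrable_rpow_indicator hρ)
    (hf.of_le (by simp)) x).const_mul _

lemma leftInt_eq_lineInt (ρ : ℝ) {f : ℝ → ℂ} (hf : tsupport f ⊆ Lam) {x : ℝ} (hx : -1 ≤ x) :
    leftInt ρ f x = lineInt ρ f x := by
  rw [leftInt, lineInt]
  congr 1
  have h := intervalIntegral.integral_comp_sub_left (a := 0) (b := x + 1)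
    (fun t => (((x - t) ^ (ρ - 1) : ℝ) : ℂ) * f t) x
  simp only [sub_sub_cancel, sub_zero, sub_add_cancel_left] at h
  rw [← h, intervalIntegral.integral_of_le (by linarith)]
  refine (setIntegral_eq_of_subset_of_forall_sdiff_eq_zero measurableSet_Ioi
    Ioc_subset_Ioi_self fun s hs => ?_).symm
  have h1 : ¬ s ≤ x + 1 := fun h => hs.2 ⟨hs.1, h⟩
  have h2 : x - s ∉ tsupport f := fun h => by linarith [(hf h).1]
  rw [image_eq_zero_of_notMem_tsupport h2, mul_zero]

/-- Integrals of a power kernel against a function supported away from the singularity. -/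
lemma hasDerivAt_integral_rpow {v : ℝ → ℂ} {c : ℝ} (hv : IntegrableOn v (Ioc (-1) c)) (a : ℝ)
    {x : ℝ} (hx : c < x) :
    HasDerivAt (fun x => ∫ t in Ioc (-1) c, (((x - t) ^ a : ℝ) : ℂ) * v t)
      ((a : ℂ) * ∫ t in Ioc (-1) c, (((x - t) ^ (a - 1) : ℝ) : ℂ) * v t) x := by
  rw [← integral_const_mul]
  have hcont : ∀ b y : ℝ, c < y → ContinuousOn (fun t : ℝ => (y - t) ^ b) (Ioc (-1) c) := by
    intro b y hy t ht
    exact ((continuousAt_const.sub continuousAt_id).rpow_const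
      (Or.inl (by simp; linarith [ht.2]))).continuousWithinAt
  have hmeas : ∀ b y : ℝ, c < y → AEStronglyMeasurable
      (fun t => (((y - t) ^ b : ℝ) : ℂ) * v t) (volume.restrict (Ioc (-1) c)) := by
    intro b y hy
    exact ((Complex.continuous_ofReal.comp_continuousOn (hcont b y hy)).aestronglyMeasurable
      measurableSet_Ioc).mul hv.aestronglyMeasurable
  have hbd : ∀ b : ℝ, ∃ B : ℝ, ∀ s ∈ Icc ((x - c) / 2) (x + (x - c) / 2 + 1), |s ^ b| ≤ B := by
    intro b
    have hc : ContinuousOn (fun s : ℝ => s ^ b) (Icc ((x - c) / 2) (x + (x - c) / 2 + 1)) := by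
      intro s hs
      exact (continuousAt_id.rpow_const (Or.inl (by simp; linarith [hs.1]))).continuousWithinAt
    obtain ⟨B, hB⟩ := isCompact_Icc.exists_bound_of_continuousOn hc
    exact ⟨B, hB⟩
  -- For `y` near `x` the differences `y - t` stay in a compact interval of positive numbers, where
  -- every power is bounded; this gives the dominating functions.
  have hmem : ∀ y ∈ Metric.ball x ((x - c) / 2), ∀ t ∈ Ioc (-1) c,
      y - t ∈ Icc ((x - c) / 2) (x + (x - c) / 2 + 1) := by
    intro y hy t ht
    rw [Real.ball_eq_Ioo] at hy
    constructor <;> linarith [hy.1, hy.2, ht.1, ht.2]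
  obtain ⟨B, hB⟩ := hbd (a - 1)
  obtain ⟨B₀, hB₀⟩ := hbd a
  have hpos : 0 < (x - c) / 2 := by linarith
  refine (hasDerivAt_integral_of_dominated_loc_of_deriv_le
    (F' := fun y t => (a : ℂ) * ((((y - t) ^ (a - 1) : ℝ) : ℂ) * v t))
    (bound := fun t => |a| * (B * ‖v t‖)) (Metric.ball_mem_nhds x hpos) ?_ ?_ ?_ ?_ ?_ ?_).2
  · filter_upwards [lt_mem_nhds hx] with y hy using hmeas a y hy
  · refine (hv.norm.const_mul B₀).mono' (hmeas a x hx) ?_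
    refine (ae_restrict_iff' measurableSet_Ioc).2 (Eventually.of_forall fun t ht => ?_)
    rw [norm_mul, Complex.norm_real]
    exact mul_le_mul_of_nonneg_right (hB₀ _ (hmem x (Metric.mem_ball_self hpos) t ht))
      (norm_nonneg _)
  · exact (hmeas (a - 1) x hx).const_mul _
  · refine (ae_restrict_iff' measurableSet_Ioc).2 (Eventually.of_forall fun t ht y hy => ?_)
    rw [norm_mul, norm_mul, Complex.norm_real, Complex.norm_real, Real.norm_eq_abs]
    gcongr
    exact hB _ (hmem y hy t ht)
  · exact (hv.norm.const_mul B).const_mul _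
  · refine (ae_restrict_iff' measurableSet_Ioc).2 (Eventually.of_forall fun t ht y hy => ?_)
    have hyt : y - t ≠ 0 := by linarith [(hmem y hy t ht).1]
    have h1 : HasDerivAt (fun y : ℝ => (y - t) ^ a) (a * (y - t) ^ (a - 1)) y := by
      simpa using ((hasDerivAt_id y).sub_const t).rpow_const (p := a) (Or.inl hyt)
    refine (h1.ofReal_comp.mul_const (v t)).congr_deriv ?_
    push_cast; ring

lemma intervalIntegrable_kernel_mul {ρ : ℝ} (hρ : 0 < ρ) {u : ℝ → ℂ} {B : ℝ}
    (hu : ContinuousOn u Lam) (hB : ∀ x ∈ Lam, ‖u x‖ ≤ B) {x : ℝ} (hx : x ∈ Lam) :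
    IntervalIntegrable (fun t => (((x - t) ^ (ρ - 1) : ℝ) : ℂ) * u t) volume (-1) x := by
  have hk : IntervalIntegrable (fun t : ℝ => (x - t) ^ (ρ - 1)) volume (-1) x := by
    have := (intervalIntegral.intervalIntegrable_rpow' (a := x - (-1)) (b := x - x)
      (show -1 < ρ - 1 by linarith)).comp_sub_left x
    simpa using this
  rw [intervalIntegrable_iff_integrableOn_Ioo_of_le hx.1.le] at hk ⊢
  have hsub : Ioo (-1) x ⊆ Lam := fun t ht => ⟨ht.1, ht.2.trans hx.2⟩
  refine Integrable.mul_bdd (c := B) (hk.ofReal (𝕜 := ℂ))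
    ((hu.mono hsub).aestronglyMeasurable measurableSet_Ioo) ?_
  exact (ae_restrict_iff' measurableSet_Ioo).2 (Eventually.of_forall fun t ht => hB t (hsub ht))

lemma norm_one_sub_mul_le {χ B : ℝ} {z : ℂ} (hχ : χ ∈ Icc (0 : ℝ) 1) (hz : ‖z‖ ≤ B) :
    ‖(1 - (χ : ℂ)) * z‖ ≤ B := by
  rw [norm_mul, ← Complex.ofReal_one, ← Complex.ofReal_sub, Complex.norm_real,
    Real.norm_of_nonneg (by linarith [hχ.2])]
  exact (mul_le_of_le_one_left (norm_nonneg _) (by linarith [hχ.1])).trans hz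

lemma norm_cutoff_mul_le {χ B : ℝ} {z : ℂ} (hχ : χ ∈ Icc (0 : ℝ) 1) (hz : ‖z‖ ≤ B) :
    ‖(χ : ℂ) * z‖ ≤ B := by
  rw [norm_mul, Complex.norm_real, Real.norm_of_nonneg hχ.1]
  exact (mul_le_of_le_one_left (norm_nonneg _) hχ.2).trans hz

/-- A smooth cutoff supported in `Λ` that is equal to `1` near a point. -/
structure IsCutoffAt (χ : ℝ → ℝ) (x₀ δ : ℝ) : Prop where
  contDiff : ContDiff ℝ ∞ χ
  tsupport_subset : tsupport χ ⊆ Lam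
  mem_Icc : ∀ x, χ x ∈ Icc (0 : ℝ) 1
  pos : 0 < δ
  eq_one : ∀ x ∈ Metric.ball x₀ δ, χ x = 1

lemma IsCutoffAt.ball_subset {χ : ℝ → ℝ} {x₀ δ : ℝ} (h : IsCutoffAt χ x₀ δ) :
    Metric.ball x₀ δ ⊆ Lam := fun x hx =>
  h.tsupport_subset (subset_tsupport χ (by simp [h.eq_one x hx]))

lemma IsCutoffAt.mem {χ : ℝ → ℝ} {x₀ δ : ℝ} (h : IsCutoffAt χ x₀ δ) : x₀ ∈ Lam :=
  h.ball_subset (Metric.mem_ball_self h.pos)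

lemma exists_isCutoffAt {x₀ : ℝ} (hx : x₀ ∈ Lam) : ∃ χ δ, IsCutoffAt χ x₀ δ := by
  obtain ⟨ε, hε, hb⟩ := Metric.isOpen_iff.1 isOpen_Lam x₀ hx
  let b : ContDiffBump x₀ := ⟨ε / 3, ε / 2, by positivity, by linarith⟩
  refine ⟨b, ε / 3, b.contDiff, ?_, fun x => ⟨b.nonneg, b.le_one⟩, by positivity, fun x hx => ?_⟩
  · rw [b.tsupport_eq]
    exact (Metric.closedBall_subset_ball (by simp [b]; linarith)).trans hb
  · exact b.one_of_mem_closedBall (Metric.ball_subset_closedBall hx)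

section local_structure

variable {ρ : ℝ} {u : ℝ → ℂ} {B : ℝ} {χ : ℝ → ℝ} {x₀ δ : ℝ}

/-- The successive derivatives of `leftInt ρ u` near a point where `χ = 1`. -/
def leftIntJet (ρ : ℝ) (u : ℝ → ℂ) (χ : ℝ → ℝ) (c : ℝ) (k : ℕ) (x : ℝ) : ℂ :=
  lineInt ρ (iteratedDeriv k fun x => (χ x : ℂ) * u x) x +
    (((Real.Gamma ρ)⁻¹ : ℝ) : ℂ) * ((∏ i ∈ Finset.range k, (ρ - 1 - i) : ℝ) : ℂ) *
      ∫ t in Ioc (-1) c, (((x - t) ^ (ρ - 1 - k) : ℝ) : ℂ) * ((1 - (χ t : ℂ)) * u t)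

lemma integrableOn_one_sub_cutoff_mul (hu : ContinuousOn u Lam) (hB : ∀ x ∈ Lam, ‖u x‖ ≤ B)
    (hχ : IsCutoffAt χ x₀ δ) : IntegrableOn (fun t => (1 - (χ t : ℂ)) * u t) Lam := by
  refine integrableOn_Lam_of_bound ?_ fun x hx => norm_one_sub_mul_le (hχ.mem_Icc x) (hB x hx)
  have := hχ.contDiff.continuous
  exact ContinuousOn.mul (by fun_prop) hu

/-- In the splitting `u = χu + (1 - χ)u`, derivatives of the first part fall on the smooth function
and those of the second on the kernel, which is not singular there. Each of the latter brings down
one more factor of the product. -/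
lemma hasDerivAt_leftIntJet (hρ : 0 < ρ) (hu : ContDiffOn ℝ ∞ u Lam) (hB : ∀ x ∈ Lam, ‖u x‖ ≤ B)
    (hχ : IsCutoffAt χ x₀ δ) (k : ℕ) {x : ℝ} (hx : x ∈ Metric.ball x₀ δ) :
    HasDerivAt (leftIntJet ρ u χ (x₀ - δ) k) (leftIntJet ρ u χ (x₀ - δ) (k + 1) x) x := by
  have hs := (tsupport_cutoff_mul_subset χ u).trans hχ.tsupport_subset
  have h1 := hasDerivAt_lineInt hρ
    (contDiff_iteratedDeriv (contDiff_cutoff_mul hχ.contDiff hχ.tsupport_subset hu) k)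
    (hasCompactSupport_iteratedDeriv (hasCompactSupport_of_tsupport_subset_Lam hs) k) x
  rw [← iteratedDeriv_succ] at h1
  rw [Real.ball_eq_Ioo] at hx
  have hsub : Ioc (-1) (x₀ - δ) ⊆ Lam := fun t ht =>
    ⟨ht.1, by linarith [hχ.mem.2, hχ.pos, ht.2]⟩
  have h2 := hasDerivAt_integral_rpow ((integrableOn_one_sub_cutoff_mul hu.continuousOn hB hχ).mono_set
    hsub) (ρ - 1 - k) hx.1
  have h3 := h1.add (h2.const_mul ((((Real.Gamma ρ)⁻¹ : ℝ) : ℂ) *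
    ((∏ i ∈ Finset.range k, (ρ - 1 - i) : ℝ) : ℂ)))
  refine h3.congr_deriv ?_
  rw [leftIntJet, Finset.prod_range_succ]
  push_cast
  rw [show ρ - 1 - (k + 1) = ρ - 1 - k - 1 by ring]
  ring

/-- For `x` in the ball, `1 - χ` vanishes between `x₀ - δ` and `x`, so the integral of the second
part stops at the fixed endpoint `x₀ - δ`, independent of `x`. -/
lemma leftInt_eq_leftIntJet (hρ : 0 < ρ) (hu : ContDiffOn ℝ ∞ u Lam) (hB : ∀ x ∈ Lam, ‖u x‖ ≤ B)
    (hχ : IsCutoffAt χ x₀ δ) :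
    EqOn (leftInt ρ u) (leftIntJet ρ u χ (x₀ - δ) 0) (Metric.ball x₀ δ) := by
  intro x hx
  have hxL := hχ.ball_subset hx
  have hs := (tsupport_cutoff_mul_subset χ u).trans hχ.tsupport_subset
  have hcχ : Continuous fun t => (χ t : ℂ) :=
    Complex.continuous_ofReal.comp hχ.contDiff.continuous
  rw [leftIntJet, iteratedDeriv_zero, ← leftInt_eq_lineInt ρ hs hxL.1.le, leftInt, leftInt,
    Finset.prod_range_zero, Complex.ofReal_one, mul_one, ← mul_add]
  congr 1
  have hi1 := intervalIntegrable_kernel_mul hρ (u := fun t => (χ t : ℂ) * u t) (B := B)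
    (hcχ.continuousOn.mul hu.continuousOn) (fun t ht => norm_cutoff_mul_le (hχ.mem_Icc t) (hB t ht)) hxL
  have hi2 := intervalIntegrable_kernel_mul hρ (u := fun t => (1 - (χ t : ℂ)) * u t) (B := B)
    ((continuous_const.sub hcχ).continuousOn.mul hu.continuousOn)
    (fun t ht => norm_one_sub_mul_le (hχ.mem_Icc t) (hB t ht)) hxL
  have e1 : ∫ t in (-1)..x, (((x - t) ^ (ρ - 1) : ℝ) : ℂ) * u t =
      (∫ t in (-1)..x, (((x - t) ^ (ρ - 1) : ℝ) : ℂ) * ((χ t : ℂ) * u t)) +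
      ∫ t in (-1)..x, (((x - t) ^ (ρ - 1) : ℝ) : ℂ) * ((1 - (χ t : ℂ)) * u t) := by
    rw [← intervalIntegral.integral_add hi1 hi2]
    congr 1; funext t; ring
  rw [e1]
  congr 1
  rw [Real.ball_eq_Ioo] at hx
  rw [intervalIntegral.integral_of_le hxL.1.le, Nat.cast_zero, sub_zero]
  refine setIntegral_eq_of_subset_of_forall_sdiff_eq_zero measurableSet_Ioc
    (Ioc_subset_Ioc_right hx.1.le) fun t ht => ?_
  have h1 : x₀ - δ < t := by
    by_contra! h; exact ht.2 ⟨ht.1.1, h⟩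
  rw [hχ.eq_one t (by rw [Real.ball_eq_Ioo]; exact ⟨h1, ht.1.2.trans_lt hx.2⟩)]
  simp

lemma iteratedDeriv_leftInt (hρ : 0 < ρ) (hu : ContDiffOn ℝ ∞ u Lam) (hB : ∀ x ∈ Lam, ‖u x‖ ≤ B)
    (hχ : IsCutoffAt χ x₀ δ) (k : ℕ) :
    iteratedDeriv k (leftInt ρ u) x₀ = leftIntJet ρ u χ (x₀ - δ) k x₀ :=
  iteratedDeriv_eq_of_hasDerivAt Metric.isOpen_ball (leftInt_eq_leftIntJet hρ hu hB hχ)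
    (fun j _ hx => hasDerivAt_leftIntJet hρ hu hB hχ j hx) k (Metric.mem_ball_self hχ.pos)

lemma contDiffOn_leftInt (hρ : 0 < ρ) (hu : ContDiffOn ℝ ∞ u Lam) (hB : ∀ x ∈ Lam, ‖u x‖ ≤ B) :
    ContDiffOn ℝ ∞ (leftInt ρ u) Lam := by
  intro x₀ hx₀
  obtain ⟨χ, δ, hχ⟩ := exists_isCutoffAt hx₀
  exact ((contDiffOn_of_hasDerivAt Metric.isOpen_ball (leftInt_eq_leftIntJet hρ hu hB hχ)
    (fun j _ hx => hasDerivAt_leftIntJet hρ hu hB hχ j hx)).contDiffAt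
      (Metric.ball_mem_nhds x₀ hχ.pos)).contDiffWithinAt

end local_structure

lemma neg_mem_Lam {x : ℝ} (hx : x ∈ Lam) : -x ∈ Lam :=
  ⟨by linarith [hx.2], by linarith [hx.1]⟩

lemma rightInt_eq (ρ : ℝ) (v : ℝ → ℂ) (x : ℝ) :
    rightInt ρ v x = leftInt ρ (fun t => v (-t)) (-x) := by
  rw [rightInt, leftInt]
  congr 1
  have := intervalIntegral.integral_comp_neg (a := -1) (b := -x)
    (fun t => (((t - x) ^ (ρ - 1) : ℝ) : ℂ) * v t)
  rw [neg_neg, neg_neg] at this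
  rw [← this]
  congr 1; funext t; ring_nf

/-- The sign `(-1)^k` in the right derivative is exactly the one that the chain rule produces under
reflection. Statements about right derivatives thus follow from those about left ones. -/
lemma rightDeriv_eq (s : ℝ) (v : ℝ → ℂ) (x : ℝ) :
    rightDeriv s v x = leftDeriv s (fun t => v (-t)) (-x) := by
  rw [rightDeriv, leftDeriv, funext (rightInt_eq _ v), iteratedDeriv_comp_neg, Complex.real_smul,
    ← mul_assoc]
  push_cast
  rw [← mul_pow]
  norm_num

lemma contDiffOn_comp_neg {u : ℝ → ℂ} {n : WithTop ℕ∞} (hu : ContDiffOn ℝ n u Lam) :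
    ContDiffOn ℝ n (fun t => u (-t)) Lam :=
  hu.comp contDiff_neg.contDiffOn fun _ hx => neg_mem_Lam hx

lemma ceilOrder_sub_pos (s : ℝ) : 0 < (ceilOrder s : ℝ) - s := by
  rw [ceilOrder]; push_cast; linarith [Nat.lt_floor_add_one s]

theorem RLDefined_of_contDiffOn (s : ℝ) {u : ℝ → ℂ} {B : ℝ} (hu : ContDiffOn ℝ ∞ u Lam)
    (hB : ∀ x ∈ Lam, ‖u x‖ ≤ B) : RLDefined s u := by
  have hρ := ceilOrder_sub_pos s
  have hun := contDiffOn_comp_neg hu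
  have hBn : ∀ x ∈ Lam, ‖u (-x)‖ ≤ B := fun x hx => hB _ (neg_mem_Lam hx)
  refine ⟨fun x hx => ⟨intervalIntegrable_kernel_mul hρ hu.continuousOn hB hx, ?_⟩,
    (contDiffOn_leftInt hρ hu hB).of_le (by exact_mod_cast le_top), ?_⟩
  · have := (intervalIntegrable_kernel_mul hρ hun.continuousOn hBn (neg_mem_Lam hx)).comp_sub_left 0
    simp only [zero_sub, neg_neg, sub_neg_eq_add, zero_add] at this
    refine this.symm.congr fun t _ => ?_
    simp only [neg_add_eq_sub]
  · rw [funext (rightInt_eq _ u)]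
    exact (contDiffOn_comp_neg (contDiffOn_leftInt hρ hun hBn)).of_le (by exact_mod_cast le_top)

end RieszJacobi
end

/-! ### The Fourier symbol of the two-sided fractional derivative -/

noncomputable section
namespace RieszJacobi
open scoped ContDiff FourierTransform
open Complex (I)

section Laplace

lemma integrableOn_rpow_mul_exp_neg {a b : ℝ} (ha : -1 < a) (hb : 0 < b) :
    IntegrableOn (fun s : ℝ => s ^ a * Real.exp (-(b * s))) (Ioi 0) := by
  simpa using integrableOn_rpow_mul_exp_neg_mul_rpow ha one_pos hb

lemma aestronglyMeasurable_rpow_mul {a : ℝ} {f : ℝ → ℂ} (hf : Continuous f) :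
    AEStronglyMeasurable (fun s : ℝ => ((s ^ a : ℝ) : ℂ) * f s) (volume.restrict (Ioi 0)) := by
  have : Measurable fun s : ℝ => s ^ a := measurable_id.pow_const a
  exact (Complex.measurable_ofReal.comp this).aestronglyMeasurable.mul hf.aestronglyMeasurable

lemma differentiableAt_laplace_rpow {ρ : ℝ} (hρ : 0 < ρ) {z : ℂ} (hz : 0 < z.re) :
    DifferentiableAt ℂ
      (fun z : ℂ => ∫ s in Ioi (0 : ℝ), ((s ^ (ρ - 1) : ℝ) : ℂ) * Complex.exp (-(z * s))) z := by
  have hb : 0 < z.re / 2 := by positivity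
  refine (hasDerivAt_integral_of_dominated_loc_of_deriv_le
    (F' := fun (z : ℂ) (s : ℝ) => ((s ^ (ρ - 1) : ℝ) : ℂ) * (Complex.exp (-(z * s)) * -s))
    (bound := fun s => s ^ ρ * Real.exp (-(z.re / 2 * s)))
    (Metric.ball_mem_nhds z hb) ?_ ?_ ?_ ?_ ?_ ?_).2.differentiableAt
  · exact Eventually.of_forall fun y => aestronglyMeasurable_rpow_mul (by fun_prop)
  · refine (integrableOn_rpow_mul_exp_neg (a := ρ - 1) (by linarith) hz).mono'
      (aestronglyMeasurable_rpow_mul (by fun_prop)) ?_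
    refine (ae_restrict_iff' measurableSet_Ioi).2 (Eventually.of_forall fun s hs => ?_)
    rw [norm_mul, Complex.norm_real, Complex.norm_exp,
      Real.norm_of_nonneg (Real.rpow_nonneg (le_of_lt hs) _)]
    simp
  · exact aestronglyMeasurable_rpow_mul (by fun_prop)
  · refine (ae_restrict_iff' measurableSet_Ioi).2 (Eventually.of_forall fun s hs y hy => ?_)
    have hs0 : 0 < s := hs
    have hre : z.re / 2 ≤ y.re := by
      have h1 := (Complex.abs_re_le_norm (y - z)).trans (mem_ball_iff_norm.1 hy).le
      rw [Complex.sub_re] at h1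
      linarith [(abs_le.1 h1).1]
    rw [norm_mul, norm_mul, Complex.norm_real, Complex.norm_exp, norm_neg, Complex.norm_real,
      Real.norm_of_nonneg (Real.rpow_nonneg hs0.le _), Real.norm_of_nonneg hs0.le]
    have e : s ^ ρ = s ^ (ρ - 1) * s := by rw [← Real.rpow_add_one hs0.ne', sub_add_cancel]
    rw [e]
    have e2 : (-(y * (s : ℂ))).re = -(y.re * s) := by simp
    rw [e2, mul_assoc, mul_comm s]
    gcongr
  · exact integrableOn_rpow_mul_exp_neg (by linarith) hb
  · refine (ae_restrict_iff' measurableSet_Ioi).2 (Eventually.of_forall fun s hs y hy => ?_)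
    have h1 : HasDerivAt (fun y : ℂ => -(y * (s : ℂ))) (-(s : ℂ)) y := by
      exact ((hasDerivAt_id y).mul_const (s : ℂ)).neg.congr_deriv (by simp)
    exact h1.cexp.const_mul _

lemma laplace_rpow_ofReal {ρ : ℝ} (hρ : 0 < ρ) {b : ℝ} (hb : 0 < b) :
    ∫ s in Ioi (0 : ℝ), ((s ^ (ρ - 1) : ℝ) : ℂ) * Complex.exp (-((b : ℂ) * s)) =
      Real.Gamma ρ * (b : ℂ) ^ (-(ρ : ℂ)) := by
  have h := Real.integral_rpow_mul_exp_neg_mul_Ioi hρ hb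
  have e : ∫ s in Ioi (0 : ℝ), ((s ^ (ρ - 1) : ℝ) : ℂ) * Complex.exp (-((b : ℂ) * s)) =
      ((∫ s in Ioi (0 : ℝ), s ^ (ρ - 1) * Real.exp (-(b * s)) : ℝ) : ℂ) := by
    rw [← integral_complex_ofReal]
    congr 1; funext s; push_cast; rfl
  rw [e, h, one_div, Real.inv_rpow hb.le, ← Real.rpow_neg hb.le]
  push_cast
  rw [Complex.ofReal_cpow hb.le]
  push_cast; ring

/-- Both sides are analytic in the right half plane and agree on the reals above `1`, so the
identity theorem applies. -/
lemma laplace_rpow {ρ : ℝ} (hρ : 0 < ρ) {z : ℂ} (hz : 0 < z.re) :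
    ∫ s in Ioi (0 : ℝ), ((s ^ (ρ - 1) : ℝ) : ℂ) * Complex.exp (-(z * s)) =
      Real.Gamma ρ * z ^ (-(ρ : ℂ)) := by
  have hU : IsOpen {z : ℂ | 0 < z.re} := isOpen_lt continuous_const Complex.continuous_re
  have hf : AnalyticOnNhd ℂ (fun z : ℂ => ∫ s in Ioi (0 : ℝ),
      ((s ^ (ρ - 1) : ℝ) : ℂ) * Complex.exp (-(z * s))) {z : ℂ | 0 < z.re} :=
    DifferentiableOn.analyticOnNhd
      (fun z hz => (differentiableAt_laplace_rpow hρ hz).differentiableWithinAt) hU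
  have hg : AnalyticOnNhd ℂ (fun z : ℂ => (Real.Gamma ρ : ℂ) * z ^ (-(ρ : ℂ))) {z : ℂ | 0 < z.re} :=
    DifferentiableOn.analyticOnNhd (fun z hz => (DifferentiableAt.const_mul
      (differentiableAt_id.cpow_const (Or.inl hz)) _).differentiableWithinAt) hU
  refine hf.eqOn_of_preconnected_of_frequently_eq hg
    (convex_halfSpace_re_gt 0).isPreconnected (z₀ := 1) (by simp) ?_ hz
  have ht : Tendsto (fun x : ℝ => (x : ℂ)) (𝓝[>] 1) (𝓝[≠] 1) := by
    refine tendsto_nhdsWithin_iff.2 ⟨?_, ?_⟩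
    · have := Complex.continuous_ofReal.tendsto (1 : ℝ)
      rw [Complex.ofReal_one] at this
      exact this.mono_left nhdsWithin_le_nhds
    · filter_upwards [self_mem_nhdsWithin] with x hx
      have : (1 : ℝ) < x := hx
      simpa using this.ne'
  refine ht.frequently (Eventually.frequently ?_)
  filter_upwards [self_mem_nhdsWithin] with x hx
  exact laplace_rpow_ofReal hρ (lt_trans zero_lt_one hx)

end Laplace

lemma I_mul_cpow_add {y : ℝ} (hy : 0 < y) (a : ℝ) :
    ((y : ℂ) * I) ^ (a : ℂ) + ((y : ℂ) * -I) ^ (a : ℂ) =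
      ((2 * Real.cos (Real.pi * a / 2) * y ^ a : ℝ) : ℂ) := by
  have hy' : (y : ℂ) ≠ 0 := by exact_mod_cast hy.ne'
  rw [Complex.cpow_def_of_ne_zero (by simp [hy']), Complex.cpow_def_of_ne_zero (by simp [hy']),
    Complex.log_ofReal_mul hy Complex.I_ne_zero,
    Complex.log_ofReal_mul hy (neg_ne_zero.2 Complex.I_ne_zero), Complex.log_I, Complex.log_neg_I,
    Real.rpow_def_of_pos hy]
  push_cast
  rw [Complex.two_cos, add_mul, add_mul, Complex.exp_add, Complex.exp_add, ← mul_add, mul_comm]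
  congr 3 <;> ring

/-- The bases have arguments `±π/2`, so the phases `e^{±iπa/2}` add up to a cosine. This is the
source of the cosine in the normalization of the Riesz derivative. -/
lemma symbol_eq {y : ℝ} (hy : y ≠ 0) (a : ℝ) :
    ((y : ℂ) * I) ^ (a : ℂ) + (-((y : ℂ) * I)) ^ (a : ℂ) =
      ((2 * Real.cos (Real.pi * a / 2) * |y| ^ a : ℝ) : ℂ) := by
  rcases lt_or_gt_of_ne hy with h | h
  · have := I_mul_cpow_add (neg_pos.2 h) a
    rw [abs_of_neg h, ← this, add_comm]
    push_cast
    ring_nf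
  · have := I_mul_cpow_add h a
    rw [abs_of_pos h, ← this]
    ring_nf

/-- The character `exp(2πiwx)`. -/
def chi (w x : ℝ) : ℂ := Complex.exp ((2 * Real.pi * w * x : ℝ) * I)

lemma norm_chi (w x : ℝ) : ‖chi w x‖ = 1 := Complex.norm_exp_ofReal_mul_I _

lemma continuous_chi : Continuous fun p : ℝ × ℝ => chi p.1 p.2 := by
  unfold chi; fun_prop

lemma continuous_chi_left (x : ℝ) : Continuous fun w => chi w x := by
  unfold chi; fun_prop

lemma SchwartzMap.eq_integral_chi (f : SchwartzMap ℝ ℂ) (x : ℝ) :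
    f x = ∫ w, (𝓕 f) w * chi w x := by
  have h := f.integrable.fourierInv_fourier_eq (v := x)
    (by simpa using (𝓕 f).integrable) f.continuous.continuousAt
  rw [← h, Real.fourierInv_eq']
  congr 1; funext w
  rw [smul_eq_mul, mul_comm, chi, SchwartzMap.fourier_coe]
  congr 3
  simp; ring

/-- The multiplier `|2πw|^s` applied to a function. -/
def fourierRiesz (s : ℝ) (f : ℝ → ℂ) (x : ℝ) : ℂ :=
  ∫ w, ((|2 * Real.pi * w| ^ s : ℝ) : ℂ) * 𝓕 f w * chi w x

lemma rpow_le_one_add_pow {t s : ℝ} (ht : 0 ≤ t) (hs : 0 ≤ s) {n : ℕ} (hn : s ≤ n) :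
    t ^ s ≤ 1 + t ^ n := by
  rcases le_total t 1 with h | h
  · have := Real.rpow_le_one ht h hs
    have : 0 ≤ t ^ n := by positivity
    linarith
  · have := Real.rpow_le_rpow_of_exponent_le h hn
    rw [Real.rpow_natCast] at this
    linarith

lemma continuous_multiplier {s : ℝ} (hs : 0 ≤ s) :
    Continuous fun w : ℝ => ((|2 * Real.pi * w| ^ s : ℝ) : ℂ) :=
  Complex.continuous_ofReal.comp
    ((continuous_abs.comp (by fun_prop)).rpow_const fun _ => Or.inr hs)

lemma norm_multiplier_le {s : ℝ} (hs : 0 ≤ s) {n : ℕ} (hn : s ≤ n) (w : ℝ) :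
    ‖((|2 * Real.pi * w| ^ s : ℝ) : ℂ)‖ ≤ 1 + (2 * Real.pi) ^ n * ‖w‖ ^ n := by
  rw [Complex.norm_real, Real.norm_of_nonneg (by positivity)]
  refine (rpow_le_one_add_pow (abs_nonneg _) hs hn).trans (le_of_eq ?_)
  rw [abs_mul, abs_of_pos (by positivity : (0 : ℝ) < 2 * Real.pi), mul_pow, Real.norm_eq_abs]

lemma integrable_multiplier_bound (g : SchwartzMap ℝ ℂ) (n : ℕ) :
    Integrable fun w : ℝ => (1 + (2 * Real.pi) ^ n * ‖w‖ ^ n) * ‖g w‖ := by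
  have := (g.integrable (μ := volume)).norm.add
    ((g.integrable_pow_mul volume n).const_mul ((2 * Real.pi) ^ n))
  refine this.congr (Eventually.of_forall fun w => ?_)
  simp only [Pi.add_apply]; ring

lemma integrable_multiplier_mul {s : ℝ} (hs : 0 ≤ s) (g : SchwartzMap ℝ ℂ) :
    Integrable fun w : ℝ => ((|2 * Real.pi * w| ^ s : ℝ) : ℂ) * g w := by
  obtain ⟨n, hn⟩ := exists_nat_ge s
  refine (integrable_multiplier_bound g n).mono'
    ((continuous_multiplier hs).mul g.continuous).aestronglyMeasurable
    (Eventually.of_forall fun w => ?_)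
  rw [norm_mul]
  gcongr
  exact norm_multiplier_le hs hn w

/-- The damping `e^{-εs}` makes the kernel integrable. Fourier inversion of `ψ` and Fubini are then
legitimate, and the inner integral is the Laplace transform at `ε + 2πiw`. -/
lemma lineInt_regularized (ψ : SchwartzMap ℝ ℂ) {ρ ε : ℝ} (hρ : 0 < ρ) (hε : 0 < ε) (x : ℝ) :
    ∫ s in Ioi (0 : ℝ), ((s ^ (ρ - 1) : ℝ) : ℂ) * (Real.exp (-(ε * s)) * ψ (x - s)) =
      (Real.Gamma ρ : ℂ) * ∫ w : ℝ, ((ε : ℂ) + (2 * Real.pi * w : ℝ) * I) ^ (-(ρ : ℂ)) * (𝓕 ψ) w * chi w x := by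
  have hsplit : ∀ w s : ℝ, (Real.exp (-(ε * s)) : ℂ) * chi w (x - s) =
      chi w x * Complex.exp (-(((ε : ℂ) + (2 * Real.pi * w : ℝ) * I) * s)) := by
    intro w s
    rw [chi, chi, Complex.ofReal_exp, ← Complex.exp_add, ← Complex.exp_add]
    congr 1; push_cast; ring
  have hker : IntegrableOn (fun s : ℝ => ((s ^ (ρ - 1) : ℝ) : ℂ) * (Real.exp (-(ε * s)) : ℂ)) (Ioi 0) := by
    have := (integrableOn_rpow_mul_exp_neg (a := ρ - 1) (by linarith) hε).ofReal (𝕜 := ℂ)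
    refine this.congr (Eventually.of_forall fun s => ?_)
    simp
  have hprod : Integrable (Function.uncurry fun (s w : ℝ) =>
      ((s ^ (ρ - 1) : ℝ) : ℂ) * (Real.exp (-(ε * s)) : ℂ) * ((𝓕 ψ) w * chi w (x - s)))
      ((volume.restrict (Ioi 0)).prod volume) := by
    have h1 := (hker.mul_prod ((𝓕 ψ).integrable (μ := volume))).mul_bdd (c := 1)
      (g := fun p : ℝ × ℝ => chi p.2 (x - p.1))
      (continuous_chi.comp (continuous_snd.prodMk (continuous_const.sub continuous_fst))).aestronglyMeasurable
      (Eventually.of_forall fun p => (norm_chi _ _).le)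
    refine h1.congr (Eventually.of_forall fun p => ?_)
    simp only [Function.uncurry]; ring
  have h1 : ∀ s : ℝ, ((s ^ (ρ - 1) : ℝ) : ℂ) * (Real.exp (-(ε * s)) * ψ (x - s)) =
      ∫ w : ℝ, ((s ^ (ρ - 1) : ℝ) : ℂ) * (Real.exp (-(ε * s)) : ℂ) *
        ((𝓕 ψ) w * chi w (x - s)) := fun s => by
    rw [integral_const_mul, ← SchwartzMap.eq_integral_chi, mul_assoc]
  simp only [h1]
  rw [integral_integral_swap hprod, ← integral_const_mul]
  refine integral_congr_ae (Eventually.of_forall fun w => ?_)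
  have hz : 0 < ((ε : ℂ) + (2 * Real.pi * w : ℝ) * I).re := by simpa using hε
  have e : ∀ s : ℝ, ((s ^ (ρ - 1) : ℝ) : ℂ) * (Real.exp (-(ε * s)) : ℂ) *
      ((𝓕 ψ) w * chi w (x - s)) = ((𝓕 ψ) w * chi w x) * (((s ^ (ρ - 1) : ℝ) : ℂ) *
      Complex.exp (-(((ε : ℂ) + (2 * Real.pi * w : ℝ) * I) * s))) := by
    intro s
    linear_combination (((s ^ (ρ - 1) : ℝ) : ℂ) * (𝓕 ψ) w) * hsplit w s
  simp only [e]
  rw [integral_const_mul, laplace_rpow hρ hz]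
  ring

lemma integrableOn_rpow_mul_of_hasCompactSupport {ρ : ℝ} (hρ : 0 < ρ) {f : ℝ → ℂ}
    (hf : Continuous f) (hc : HasCompactSupport f) :
    IntegrableOn (fun s : ℝ => ((s ^ (ρ - 1) : ℝ) : ℂ) * f s) (Ioi 0) := by
  have h := (locallyIntegrable_rpow_indicator hρ).integrable_smul_right_of_hasCompactSupport hf hc
  rw [← integrable_indicator_iff measurableSet_Ioi]
  refine h.congr (Eventually.of_forall fun s => ?_)
  by_cases hs : s ∈ Ioi (0 : ℝ) <;> simp [hs]

/-- The fractional integral from `-∞` of a derivative, through the Fourier transform. -/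
lemma lineInt_iteratedDeriv_eq {f : ℝ → ℂ} (hf : ContDiff ℝ ∞ f) (hc : HasCompactSupport f)
    {ρ : ℝ} (hρ : 0 < ρ) {k : ℕ} (hk : ρ ≤ k) (x : ℝ) :
    Integrable (fun w : ℝ => ((2 * Real.pi * w : ℝ) * I) ^ ((k - ρ : ℝ) : ℂ) * 𝓕 f w * chi w x) ∧
    lineInt ρ (iteratedDeriv k f) x =
      ∫ w : ℝ, ((2 * Real.pi * w : ℝ) * I) ^ ((k - ρ : ℝ) : ℂ) * 𝓕 f w * chi w x := by
  let g : SchwartzMap ℝ ℂ := hc.toSchwartzMap hf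
  have hcψ := hasCompactSupport_iteratedDeriv hc k
  -- The transform of this `k`-th derivative carries the factor `(2πiw)^k`, which cancels the
  -- singularity of `(2πiw)^{-ρ}` at the origin because `ρ ≤ k`.
  let ψ : SchwartzMap ℝ ℂ := hcψ.toSchwartzMap (contDiff_iteratedDeriv hf k)
  have hψ : ∀ w, (𝓕 ψ) w = ((2 * Real.pi * w : ℝ) * I) ^ k * 𝓕 f w := by
    intro w
    rw [SchwartzMap.fourier_coe]
    have h := Real.fourier_iteratedDeriv (f := f) (N := ⊤) (n := k) hf (fun n _ =>
      (contDiff_iteratedDeriv hf n).continuous.integrable_of_hasCompactSupport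
        (hasCompactSupport_iteratedDeriv hc n)) le_top
    have h2 := congrFun h w
    rw [smul_eq_mul] at h2
    refine h2.trans ?_
    congr 2; push_cast; ring
  have h0 : ∀ᵐ w : ℝ, w ≠ 0 := by
    rw [ae_iff]; simp
  have hy0 : ∀ w : ℝ, w ≠ 0 → ((2 * Real.pi * w : ℝ) : ℂ) * I ≠ 0 := fun w hw => by
    simp [hw, Real.pi_ne_zero]
  have hpow : ∀ w : ℝ, w ≠ 0 →
      ((2 * Real.pi * w : ℝ) * I) ^ (-(ρ : ℂ)) * (𝓕 ψ) w * chi w x =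
      ((2 * Real.pi * w : ℝ) * I) ^ ((k - ρ : ℝ) : ℂ) * 𝓕 f w * chi w x := by
    intro w hw
    rw [hψ, ← mul_assoc, ← Complex.cpow_natCast, ← Complex.cpow_add _ _ (hy0 w hw)]
    push_cast; ring_nf
  have hdom : Integrable fun w : ℝ => |2 * Real.pi * w| ^ (k - ρ) * ‖(𝓕 g) w‖ := by
    refine (integrable_multiplier_mul (s := k - ρ) (by linarith) (𝓕 g)).norm.congr
      (Eventually.of_forall fun w => ?_)
    simp only [norm_mul, Complex.norm_real]
    rw [Real.norm_of_nonneg (by positivity)]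
  have hnormψ : ∀ w : ℝ, w ≠ 0 → |2 * Real.pi * w| ^ (-ρ) * ‖(𝓕 ψ) w‖ =
      |2 * Real.pi * w| ^ (k - ρ) * ‖(𝓕 g) w‖ := by
    intro w hw
    have hpos : 0 < |2 * Real.pi * w| := by
      rw [abs_pos]; simp [hw, Real.pi_ne_zero]
    rw [hψ, norm_mul, norm_pow, norm_mul, Complex.norm_I, mul_one, Complex.norm_real,
      Real.norm_eq_abs, ← mul_assoc, ← Real.rpow_natCast, ← Real.rpow_add hpos, neg_add_eq_sub]
    rfl
  have hmeas : ∀ ε : ℝ, 0 ≤ ε → AEStronglyMeasurable (fun w : ℝ =>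
      ((ε : ℂ) + (2 * Real.pi * w : ℝ) * I) ^ (-(ρ : ℂ)) * (𝓕 ψ) w * chi w x) := by
    intro ε _
    have h1 : Measurable fun w : ℝ => ((ε : ℂ) + (2 * Real.pi * w : ℝ) * I) ^ (-(ρ : ℂ)) := by
      have : Measurable fun w : ℝ => (ε : ℂ) + (2 * Real.pi * w : ℝ) * I := by fun_prop
      exact this.pow_const _
    exact (h1.aestronglyMeasurable.mul (𝓕 ψ).continuous.aestronglyMeasurable).mul
      (continuous_chi_left x).aestronglyMeasurable
  -- The bound is uniform in `ε`: `|ε + 2πiw| ≥ |2πw|` and the exponent `-ρ` is negative. Dominated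
  -- convergence as `ε → 0` then removes the damping.
  have hbound : ∀ ε : ℝ, 0 ≤ ε → ∀ w : ℝ, w ≠ 0 →
      ‖((ε : ℂ) + (2 * Real.pi * w : ℝ) * I) ^ (-(ρ : ℂ)) * (𝓕 ψ) w * chi w x‖ ≤
        |2 * Real.pi * w| ^ (k - ρ) * ‖(𝓕 g) w‖ := by
    intro ε _ w hw
    have hpos : 0 < |2 * Real.pi * w| := by
      rw [abs_pos]; simp [hw, Real.pi_ne_zero]
    rw [norm_mul, norm_chi, mul_one, norm_mul, ← hnormψ w hw, ← Complex.ofReal_neg,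
      Complex.norm_cpow_real]
    refine mul_le_mul_of_nonneg_right ?_ (norm_nonneg _)
    refine Real.rpow_le_rpow_of_nonpos hpos ?_ (by linarith)
    have := Complex.abs_im_le_norm ((ε : ℂ) + (2 * Real.pi * w : ℝ) * I)
    simpa using this
  have hint0 : Integrable fun w : ℝ =>
      ((2 * Real.pi * w : ℝ) * I) ^ (-(ρ : ℂ)) * (𝓕 ψ) w * chi w x := by
    refine hdom.mono' ?_ (h0.mono fun w hw => ?_)
    · simpa using hmeas 0 le_rfl
    · simpa using hbound 0 le_rfl w hw
  refine ⟨hint0.congr (h0.mono hpow), ?_⟩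
  rw [← integral_congr_ae (h0.mono hpow), lineInt]
  have hL : Tendsto (fun ε : ℝ => ∫ s in Ioi (0 : ℝ), ((s ^ (ρ - 1) : ℝ) : ℂ) *
      (Real.exp (-(ε * s)) * ψ (x - s))) (𝓝[>] 0)
      (𝓝 (∫ s in Ioi (0 : ℝ), ((s ^ (ρ - 1) : ℝ) : ℂ) * ψ (x - s))) := by
    have hcont : Continuous fun s => ψ (x - s) := ψ.continuous.comp (by fun_prop)
    have hcs : HasCompactSupport fun s => ψ (x - s) :=
      HasCompactSupport.comp_homeomorph (f := ψ) hcψ (Homeomorph.subLeft x)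
    refine tendsto_integral_filter_of_dominated_convergence
      (fun s => ‖((s ^ (ρ - 1) : ℝ) : ℂ) * ψ (x - s)‖) ?_ ?_
      (integrableOn_rpow_mul_of_hasCompactSupport hρ hcont hcs).norm ?_
    · exact Eventually.of_forall fun ε => aestronglyMeasurable_rpow_mul (by fun_prop)
    · filter_upwards [self_mem_nhdsWithin] with ε hε
      refine (ae_restrict_iff' measurableSet_Ioi).2 (Eventually.of_forall fun s hs => ?_)
      rw [norm_mul, norm_mul, norm_mul]
      refine mul_le_mul_of_nonneg_left (mul_le_of_le_one_left (norm_nonneg _) ?_) (norm_nonneg _)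
      rw [Complex.norm_real, Real.norm_of_nonneg (Real.exp_pos _).le, Real.exp_le_one_iff,
        neg_nonpos]
      exact mul_nonneg (le_of_lt hε) (le_of_lt hs)
    · refine Eventually.of_forall fun s => Tendsto.mono_left ?_ nhdsWithin_le_nhds
      have : Continuous fun ε : ℝ => ((s ^ (ρ - 1) : ℝ) : ℂ) * (Real.exp (-(ε * s)) * ψ (x - s)) := by
        fun_prop
      simpa using this.tendsto 0
  have hR : Tendsto (fun ε : ℝ => (Real.Gamma ρ : ℂ) *
      ∫ w, ((ε : ℂ) + (2 * Real.pi * w : ℝ) * I) ^ (-(ρ : ℂ)) * (𝓕 ψ) w * chi w x) (𝓝[>] 0)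
      (𝓝 ((Real.Gamma ρ : ℂ) *
        ∫ w : ℝ, ((2 * Real.pi * w : ℝ) * I) ^ (-(ρ : ℂ)) * (𝓕 ψ) w * chi w x)) := by
    refine Tendsto.const_mul _ (tendsto_integral_filter_of_dominated_convergence _ ?_ ?_ hdom ?_)
    · filter_upwards [self_mem_nhdsWithin] with ε hε using hmeas ε (le_of_lt hε)
    · filter_upwards [self_mem_nhdsWithin] with ε hε using
        h0.mono (hbound ε (le_of_lt hε))
    · refine h0.mono fun w hw => Tendsto.mul_const _ (Tendsto.mul_const _ ?_)
      refine Tendsto.mono_left ?_ nhdsWithin_le_nhds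
      have hc : ContinuousAt (fun ε : ℝ => ((ε : ℂ) + (2 * Real.pi * w : ℝ) * I) ^ (-(ρ : ℂ))) 0 := by
        refine ContinuousAt.cpow (by fun_prop) continuousAt_const (Or.inr ?_)
        simp [hw, Real.pi_ne_zero]
      simpa [ContinuousAt] using hc
  have hEq := tendsto_nhds_unique (hL.congr' (by
    filter_upwards [self_mem_nhdsWithin] with ε hε using lineInt_regularized ψ hρ hε x)) hR
  have hΓ : (Real.Gamma ρ : ℂ) ≠ 0 := by exact_mod_cast (Real.Gamma_pos_of_pos hρ).ne'
  change _ * (∫ s in Ioi (0 : ℝ), ((s ^ (ρ - 1) : ℝ) : ℂ) * ψ (x - s)) = _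
  rw [hEq, Complex.ofReal_inv, inv_mul_cancel_left₀ hΓ]

lemma fourier_comp_neg (f : ℝ → ℂ) (w : ℝ) : 𝓕 (fun x => f (-x)) w = 𝓕 f (-w) := by
  rw [Real.fourier_real_eq_integral_exp_smul, Real.fourier_real_eq_integral_exp_smul,
    ← integral_neg_eq_self]
  congr 1; funext x; simp

/-- The two-sided fractional integral of a derivative is a Fourier multiplier. -/
theorem lineInt_add_lineInt_neg {f : ℝ → ℂ} (hf : ContDiff ℝ ∞ f) (hc : HasCompactSupport f)
    {ρ : ℝ} (hρ : 0 < ρ) {k : ℕ} (hk : ρ ≤ k) (x : ℝ) :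
    lineInt ρ (iteratedDeriv k f) x + lineInt ρ (iteratedDeriv k fun t => f (-t)) (-x) =
      ((2 * Real.cos (Real.pi * (k - ρ) / 2) : ℝ) : ℂ) * fourierRiesz (k - ρ) f x := by
  obtain ⟨i1, e1⟩ := lineInt_iteratedDeriv_eq hf hc hρ hk x
  obtain ⟨i2, e2⟩ := lineInt_iteratedDeriv_eq (f := fun t => f (-t)) (hf.comp contDiff_neg)
    (hc.comp_homeomorph (Homeomorph.neg ℝ)) hρ hk (-x)
  have i3 := i2.comp_neg
  -- After `w ↦ -w` both integrals contain the same transform and character, and only the symbols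
  -- `(±2πiw)^{k-ρ}` differ.
  rw [← integral_neg_eq_self] at e2
  rw [e1, e2, ← integral_add i1 i3, fourierRiesz, ← integral_const_mul]
  have h0 : ∀ᵐ w : ℝ, w ≠ 0 := by
    rw [ae_iff]; simp
  refine integral_congr_ae (h0.mono fun w hw => ?_)
  have hs := symbol_eq (y := 2 * Real.pi * w) (by simp [hw, Real.pi_ne_zero]) (k - ρ)
  have hchi : chi (-w) (-x) = chi w x := by rw [chi, chi]; congr 3; ring
  simp only [fourier_comp_neg, neg_neg, hchi]
  have e4 : ((2 * Real.pi * -w : ℝ) : ℂ) * I = -(((2 * Real.pi * w : ℝ) : ℂ) * I) := by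
    push_cast; ring
  rw [e4, ← add_mul, ← add_mul, hs]
  push_cast; ring

end RieszJacobi
end

/-! ### Duality: the Riesz derivative is bounded by the seminorm -/

noncomputable section
namespace RieszJacobi
open scoped ContDiff FourierTransform
open Complex (I)

lemma setIntegral_Lam_mul {φ : ℝ → ℂ} (hφ : tsupport φ ⊆ Lam) (g : ℝ → ℂ) :
    ∫ x in Lam, g x * φ x = ∫ x, g x * φ x :=
  setIntegral_eq_integral_of_forall_compl_eq_zero fun x hx => by
    rw [image_eq_zero_of_notMem_tsupport fun h => hx (hφ h), mul_zero]

lemma integrable_mul_of_tsupport {φ g : ℝ → ℂ} (hφ : ContDiff ℝ ∞ φ) (hs : tsupport φ ⊆ Lam)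
    (hg : ContDiffOn ℝ ∞ g Lam) : Integrable fun x => g x * φ x := by
  have h1 := contDiff_mul_of_tsupport hφ hs hg
  have h2 : HasCompactSupport fun x => φ x * g x :=
    (hasCompactSupport_of_tsupport_subset_Lam hs).mul_right
  simpa only [mul_comm] using h1.continuous.integrable_of_hasCompactSupport h2

lemma tsupport_deriv_subset_Lam {φ : ℝ → ℂ} (hs : tsupport φ ⊆ Lam) : tsupport (deriv φ) ⊆ Lam :=
  (tsupport_deriv_subset (𝕜 := ℝ)).trans hs

lemma integral_deriv_mul {φ g : ℝ → ℂ} (hφ : ContDiff ℝ ∞ φ) (hs : tsupport φ ⊆ Lam)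
    (hg : ContDiffOn ℝ ∞ g Lam) :
    ∫ x in Lam, deriv g x * φ x = -∫ x in Lam, g x * deriv φ x := by
  have hg' := (contDiffOn_infty_iff_deriv_of_isOpen isOpen_Lam).1 hg
  have hφ' := contDiff_infty_iff_deriv.1 hφ
  have hs' := tsupport_deriv_subset_Lam hs
  have i1 := integrable_mul_of_tsupport hφ hs hg'.2
  have i2 := integrable_mul_of_tsupport hφ'.2 hs' hg
  have h := integral_eq_zero_of_hasDerivAt_of_integrable (f := fun x => g x * φ x)
    (f' := fun x => deriv g x * φ x + g x * deriv φ x) (fun x => ?_) (i1.add i2)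
    (integrable_mul_of_tsupport hφ hs hg)
  · rw [integral_add i1 i2] at h
    rw [setIntegral_Lam_mul hs, setIntegral_Lam_mul hs']
    exact eq_neg_of_add_eq_zero_left h
  · by_cases hx : x ∈ tsupport φ
    · exact (hg'.1.differentiableAt (isOpen_Lam.mem_nhds (hs hx))).hasDerivAt.mul
        (hφ'.1 x).hasDerivAt
    · have e : (fun x => g x * φ x) =ᶠ[𝓝 x] fun _ => 0 := by
        filter_upwards [(isClosed_tsupport φ).isOpen_compl.mem_nhds hx] with y hy
        rw [image_eq_zero_of_notMem_tsupport hy, mul_zero]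
      rw [image_eq_zero_of_notMem_tsupport hx, image_eq_zero_of_notMem_tsupport
        (fun h => hx (tsupport_deriv_subset (𝕜 := ℝ) h)), mul_zero, mul_zero, add_zero]
      exact (hasDerivAt_const x (0 : ℂ)).congr_of_eventuallyEq e

lemma contDiffOn_iteratedDeriv {g : ℝ → ℂ} (hg : ContDiffOn ℝ ∞ g Lam) (k : ℕ) :
    ContDiffOn ℝ ∞ (iteratedDeriv k g) Lam := by
  induction k with
  | zero => simpa using hg
  | succ k ih =>
    rw [iteratedDeriv_succ]
    exact ((contDiffOn_infty_iff_deriv_of_isOpen isOpen_Lam).1 ih).2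

lemma integral_iteratedDeriv_mul {g : ℝ → ℂ} (hg : ContDiffOn ℝ ∞ g Lam) (k : ℕ) {φ : ℝ → ℂ}
    (hφ : ContDiff ℝ ∞ φ) (hs : tsupport φ ⊆ Lam) :
    ∫ x in Lam, iteratedDeriv k g x * φ x =
      (-1) ^ k * ∫ x in Lam, g x * iteratedDeriv k φ x := by
  induction k generalizing φ with
  | zero => simp
  | succ k ih =>
    rw [iteratedDeriv_succ, integral_deriv_mul hφ hs (contDiffOn_iteratedDeriv hg k),
      ih (contDiff_infty_iff_deriv.1 hφ).2 (tsupport_deriv_subset_Lam hs), iteratedDeriv_succ']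
    ring

/-- Fractional integration by parts: by Fubini, the adjoint of the left integral integrates to the
right. -/
lemma integral_leftInt_mul {ρ : ℝ} (hρ : 0 < ρ) {u ψ : ℝ → ℂ} (hu : IntegrableOn u Lam)
    (hψ : Continuous ψ) (hs : tsupport ψ ⊆ Lam) :
    ∫ x in Lam, leftInt ρ u x * ψ x = ∫ t in Lam, u t * ((((Real.Gamma ρ)⁻¹ : ℝ) : ℂ) *
      ∫ s in Ioi (0 : ℝ), ((s ^ (ρ - 1) : ℝ) : ℂ) * ψ (t + s)) := by
  -- Points of `Λ` differ by less than `2`, so truncating the kernel there changes nothing and makes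
  -- it integrable.
  let K : ℝ → ℂ := indicator (Ioo 0 2) fun s => ((s ^ (ρ - 1) : ℝ) : ℂ)
  have hK : Integrable K := by
    have h := (locallyIntegrable_rpow_indicator hρ).integrableOn_isCompact (isCompact_Icc (a := 0) (b := 2))
    have h2 : IntegrableOn (fun s : ℝ => s ^ (ρ - 1)) (Ioo 0 2) := by
      refine (h.mono_set Ioo_subset_Icc_self).congr_fun (fun s hs => ?_) measurableSet_Ioo
      rw [indicator_of_mem (mem_Ioi.2 hs.1)]
    exact (integrable_indicator_iff measurableSet_Ioo).2 (h2.ofReal (𝕜 := ℂ))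
  have hU : Integrable (indicator Lam u) := (integrable_indicator_iff measurableSet_Ioo).2 hu
  have hψc := hasCompactSupport_of_tsupport_subset_Lam hs
  obtain ⟨Bψ, hBψ⟩ := hψ.bounded_above_of_compact_support hψc
  have hprod : Integrable (Function.uncurry fun x t : ℝ =>
      indicator Lam u t * K (x - t) * ψ x) (volume.prod volume) := by
    have h := (hU.convolution_integrand (ContinuousLinearMap.mul ℝ ℂ) hK).mul_bdd (c := Bψ)
      (g := fun p : ℝ × ℝ => ψ p.1) (hψ.comp continuous_fst).aestronglyMeasurable
      (Eventually.of_forall fun p => hBψ p.1)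
    exact h
  have e1 : ∀ x ∈ Lam, leftInt ρ u x = (((Real.Gamma ρ)⁻¹ : ℝ) : ℂ) *
      ∫ t, indicator Lam u t * K (x - t) := by
    intro x hx
    rw [leftInt, intervalIntegral.integral_of_le hx.1.le, integral_Ioc_eq_integral_Ioo,
      ← integral_indicator measurableSet_Ioo]
    congr 2; funext t
    by_cases ht : t ∈ Ioo (-1) x
    · have h1 : t ∈ Lam := ⟨ht.1, ht.2.trans hx.2⟩
      have h2 : x - t ∈ Ioo (0 : ℝ) 2 := ⟨by linarith [ht.2], by linarith [ht.1, hx.2]⟩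
      simp only [K]
      rw [indicator_of_mem ht, indicator_of_mem h1, indicator_of_mem h2, mul_comm]
    · rw [indicator_of_notMem ht]
      by_cases h1 : t ∈ Lam
      · have h2 : x - t ∉ Ioo (0 : ℝ) 2 := fun h => ht ⟨h1.1, by linarith [h.1]⟩
        simp only [K]
        rw [indicator_of_notMem h2, mul_zero]
      · rw [indicator_of_notMem h1, zero_mul]
  have e2 : ∀ t ∈ Lam, ∫ s in Ioi (0 : ℝ), ((s ^ (ρ - 1) : ℝ) : ℂ) * ψ (t + s) =
      ∫ x, K (x - t) * ψ x := by
    intro t ht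
    rw [← integral_add_right_eq_self (fun x => K (x - t) * ψ x) t,
      ← integral_indicator measurableSet_Ioi]
    congr 1; funext s
    rw [add_sub_cancel_right, show s + t = t + s from add_comm s t]
    by_cases h : s ∈ Ioi (0 : ℝ)
    · rw [indicator_of_mem h]
      by_cases h2 : s < 2
      · simp only [K]
        rw [indicator_of_mem (show s ∈ Ioo (0 : ℝ) 2 from ⟨h, h2⟩)]
      · have : t + s ∉ tsupport ψ := fun h3 => by
          linarith [(hs h3).2, ht.1]
        rw [image_eq_zero_of_notMem_tsupport this, mul_zero, mul_zero]
    · have h2 : s ∉ Ioo (0 : ℝ) 2 := fun h3 => h h3.1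
      simp only [K]
      rw [indicator_of_notMem h, indicator_of_notMem h2, zero_mul]
  have l1 : ∫ x in Lam, leftInt ρ u x * ψ x = (((Real.Gamma ρ)⁻¹ : ℝ) : ℂ) *
      ∫ x, ∫ t, indicator Lam u t * K (x - t) * ψ x := by
    rw [← integral_const_mul, setIntegral_Lam_mul hs]
    congr 1; funext x
    by_cases hx : x ∈ Lam
    · rw [e1 x hx, integral_mul_const, mul_assoc]
    · have : ψ x = 0 := image_eq_zero_of_notMem_tsupport fun h => hx (hs h)
      simp [this]
  rw [l1, integral_integral_swap hprod, ← integral_const_mul,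
    ← integral_indicator (show MeasurableSet Lam from measurableSet_Ioo)]
  congr 1; funext t
  by_cases ht : t ∈ Lam
  · rw [indicator_of_mem ht, indicator_of_mem ht, e2 t ht]
    simp only [mul_assoc]
    rw [integral_const_mul]
    ring
  · rw [indicator_of_notMem ht, indicator_of_notMem ht]
    simp

lemma tsupport_comp_neg_subset {φ : ℝ → ℂ} (hs : tsupport φ ⊆ Lam) :
    tsupport (fun x => φ (-x)) ⊆ Lam := by
  intro x hx
  have : -x ∈ tsupport φ := by
    have h := tsupport_comp_subset_preimage φ (continuous_neg (G := ℝ))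
    exact h hx
  simpa using neg_mem_Lam (hs this)

/-- The adjoint is written with the reflected test function, the form in which
`lineInt_add_lineInt_neg` adds the two sides. The sign from `k` integrations by parts is absorbed by
the reflection. -/
lemma integral_leftDeriv_mul (s : ℝ) {u φ : ℝ → ℂ} {B : ℝ} (hu : ContDiffOn ℝ ∞ u Lam)
    (hB : ∀ x ∈ Lam, ‖u x‖ ≤ B) (hφ : ContDiff ℝ ∞ φ) (hs : tsupport φ ⊆ Lam) :
    ∫ x in Lam, leftDeriv s u x * φ x = ∫ t in Lam, u t *
      lineInt (ceilOrder s - s) (iteratedDeriv (ceilOrder s) fun y => φ (-y)) (-t) := by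
  have hρ := ceilOrder_sub_pos s
  set k := ceilOrder s
  simp only [leftDeriv]
  rw [integral_iteratedDeriv_mul (contDiffOn_leftInt hρ hu hB) k hφ hs,
    integral_leftInt_mul hρ (integrableOn_Lam_of_bound hu.continuousOn hB)
      (contDiff_iteratedDeriv hφ k).continuous ((tsupport_iteratedDeriv_subset φ k).trans hs),
    ← integral_const_mul]
  congr 1; funext t
  have e : ∀ σ : ℝ, iteratedDeriv k (fun y => φ (-y)) (-t - σ) =
      (-1) ^ k * iteratedDeriv k φ (t + σ) := by
    intro σ
    rw [iteratedDeriv_comp_neg, Complex.real_smul, show -(-t - σ) = t + σ by ring]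
    push_cast; rfl
  rw [lineInt]
  simp only [e]
  have e3 : ∀ σ : ℝ, ((σ ^ ((k : ℝ) - s - 1) : ℝ) : ℂ) * ((-1) ^ k * iteratedDeriv k φ (t + σ)) =
      (-1) ^ k * (((σ ^ ((k : ℝ) - s - 1) : ℝ) : ℂ) * iteratedDeriv k φ (t + σ)) := fun σ => by ring
  simp only [e3]
  rw [integral_const_mul]
  ring

lemma integral_rightDeriv_mul (s : ℝ) {u φ : ℝ → ℂ} {B : ℝ} (hu : ContDiffOn ℝ ∞ u Lam)
    (hB : ∀ x ∈ Lam, ‖u x‖ ≤ B) (hφ : ContDiff ℝ ∞ φ) (hs : tsupport φ ⊆ Lam) :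
    ∫ x in Lam, rightDeriv s u x * φ x = ∫ t in Lam, u t *
      lineInt (ceilOrder s - s) (iteratedDeriv (ceilOrder s) φ) t := by
  have h := integral_leftDeriv_mul s (contDiffOn_comp_neg hu)
    (fun x hx => hB _ (neg_mem_Lam hx)) (hφ.comp contDiff_neg) (tsupport_comp_neg_subset hs)
  rw [← integral_Lam_comp_neg, ← integral_Lam_comp_neg (fun t => u (-t) * _)] at h
  simp only [Function.comp_def, neg_neg] at h
  rw [← h]
  congr 1; funext x
  rw [rightDeriv_eq]

lemma contDiffOn_leftDeriv (s : ℝ) {u : ℝ → ℂ} {B : ℝ} (hu : ContDiffOn ℝ ∞ u Lam)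
    (hB : ∀ x ∈ Lam, ‖u x‖ ≤ B) : ContDiffOn ℝ ∞ (leftDeriv s u) Lam :=
  contDiffOn_iteratedDeriv (contDiffOn_leftInt (ceilOrder_sub_pos s) hu hB) _

lemma contDiffOn_rightDeriv (s : ℝ) {u : ℝ → ℂ} {B : ℝ} (hu : ContDiffOn ℝ ∞ u Lam)
    (hB : ∀ x ∈ Lam, ‖u x‖ ≤ B) : ContDiffOn ℝ ∞ (rightDeriv s u) Lam := by
  rw [funext (rightDeriv_eq s u)]
  exact contDiffOn_comp_neg
    (contDiffOn_leftDeriv s (contDiffOn_comp_neg hu) fun x hx => hB _ (neg_mem_Lam hx))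

lemma contDiffOn_rieszExpr (s : ℝ) {u : ℝ → ℂ} {B : ℝ} (hu : ContDiffOn ℝ ∞ u Lam)
    (hB : ∀ x ∈ Lam, ‖u x‖ ≤ B) : ContDiffOn ℝ ∞ (rieszExpr s u) Lam :=
  contDiffOn_const.mul ((contDiffOn_leftDeriv s hu hB).add (contDiffOn_rightDeriv s hu hB))

lemma continuous_lineInt {ρ : ℝ} (hρ : 0 < ρ) {f : ℝ → ℂ} (hf : ContDiff ℝ ∞ f)
    (hc : HasCompactSupport f) : Continuous (lineInt ρ f) :=
  continuous_iff_continuousAt.2 fun x => (hasDerivAt_lineInt hρ hf hc x).continuousAt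

lemma integrableOn_Lam_mul {u g : ℝ → ℂ} (hu : IntegrableOn u Lam) (hg : Continuous g) :
    IntegrableOn (fun x => u x * g x) Lam := by
  obtain ⟨M, hM⟩ := (isCompact_Icc (a := (-1 : ℝ)) (b := 1)).exists_bound_of_continuousOn
    hg.continuousOn
  exact Integrable.mul_bdd (c := M) hu hg.aestronglyMeasurable
    (ae_restrict_Lam fun x hx => hM x ⟨hx.1.le, hx.2.le⟩)

lemma integral_Lam_mul_fourierRiesz {s : ℝ} (hs0 : 0 ≤ s) {u : ℝ → ℂ} (hu : IntegrableOn u Lam)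
    (f : SchwartzMap ℝ ℂ) : ∫ t in Lam, u t * fourierRiesz s f t =
      ∫ w : ℝ, (𝓕 f) w * (((|2 * Real.pi * w| ^ s : ℝ) : ℂ) * fourierExt u (-(2 * Real.pi * w))) := by
  have hg := integrable_multiplier_mul hs0 (𝓕 f)
  have hprod : Integrable (Function.uncurry fun t w : ℝ =>
      u t * (((|2 * Real.pi * w| ^ s : ℝ) : ℂ) * (𝓕 f) w * chi w t))
      ((volume.restrict Lam).prod volume) := by
    have h := (Integrable.mul_prod hu hg).mul_bdd (c := 1) (g := fun p : ℝ × ℝ => chi p.2 p.1)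
      (continuous_chi.comp continuous_swap).aestronglyMeasurable
      (Eventually.of_forall fun p => (norm_chi _ _).le)
    refine h.congr (Eventually.of_forall fun p => ?_)
    simp only [Function.uncurry]; ring
  have e : ∀ t, u t * fourierRiesz s f t =
      ∫ w : ℝ, u t * (((|2 * Real.pi * w| ^ s : ℝ) : ℂ) * (𝓕 f) w * chi w t) := fun t => by
    rw [fourierRiesz, integral_const_mul]; rfl
  simp only [e]
  rw [integral_integral_swap hprod]
  congr 1; funext w
  rw [fourierExt, ← integral_const_mul, ← integral_const_mul]
  congr 1; funext t
  have e2 : chi w t = Complex.exp (-(I * ((-(2 * Real.pi * w) : ℝ) : ℂ) * t)) := by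
    rw [chi]; congr 1; push_cast; ring
  rw [e2]; ring

/-- The Riesz derivative tested against a smooth function supported in `Λ`. -/
lemma integral_rieszExpr_mul {s : ℝ} (hs0 : 0 ≤ s) {u φ : ℝ → ℂ} {B : ℝ}
    (hu : ContDiffOn ℝ ∞ u Lam) (hB : ∀ x ∈ Lam, ‖u x‖ ≤ B) (hφ : ContDiff ℝ ∞ φ)
    (hs : tsupport φ ⊆ Lam) :
    ‖∫ x in Lam, rieszExpr s u x * φ x‖ ≤
      ‖∫ w : ℝ, 𝓕 φ w * (((|2 * Real.pi * w| ^ s : ℝ) : ℂ) * fourierExt u (-(2 * Real.pi * w)))‖ := by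
  have hc := hasCompactSupport_of_tsupport_subset_Lam hs
  have hρ := ceilOrder_sub_pos s
  have hui := integrableOn_Lam_of_bound hu.continuousOn hB
  have hφn : ContDiff ℝ ∞ fun t => φ (-t) := hφ.comp contDiff_neg
  have hcn := hasCompactSupport_of_tsupport_subset_Lam (tsupport_comp_neg_subset hs)
  set k := ceilOrder s with hk
  set c : ℂ := (((-1) ^ ⌊(s + 1) / 2⌋₊ / (2 * Real.cos (Real.pi * s / 2)) : ℝ) : ℂ) with hcdef
  have h1 : ∫ x in Lam, (leftDeriv s u x + rightDeriv s u x) * φ x =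
      ((2 * Real.cos (Real.pi * s / 2) : ℝ) : ℂ) * ∫ t in Lam, u t * fourierRiesz s φ t := by
    simp only [add_mul]
    rw [integral_add (integrable_mul_of_tsupport hφ hs (contDiffOn_leftDeriv s hu hB)).integrableOn
      (integrable_mul_of_tsupport hφ hs (contDiffOn_rightDeriv s hu hB)).integrableOn,
      integral_leftDeriv_mul s hu hB hφ hs, integral_rightDeriv_mul s hu hB hφ hs, ← integral_add]
    · rw [← integral_const_mul]
      congr 1; funext t
      have := lineInt_add_lineInt_neg hφ hc hρ (k := k) (by linarith) t
      rw [sub_sub_cancel] at this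
      linear_combination u t * this
    · exact integrableOn_Lam_mul hui ((continuous_lineInt hρ (contDiff_iteratedDeriv hφn k)
        (hasCompactSupport_iteratedDeriv hcn k)).comp continuous_neg)
    · exact integrableOn_Lam_mul hui (continuous_lineInt hρ (contDiff_iteratedDeriv hφ k)
        (hasCompactSupport_iteratedDeriv hc k))
  have h2 : ∫ x in Lam, rieszExpr s u x * φ x =
      c * ∫ x in Lam, (leftDeriv s u x + rightDeriv s u x) * φ x := by
    rw [← integral_const_mul]
    congr 1; funext x
    rw [rieszExpr, ← hcdef, mul_assoc]
  -- The product is `±1` unless the cosine vanishes; in that case division by zero makes it `0`.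
  -- Hence an inequality, valid for every `s`.
  have h3 : ‖c * ((2 * Real.cos (Real.pi * s / 2) : ℝ) : ℂ)‖ ≤ 1 := by
    rw [hcdef, ← Complex.ofReal_mul, Complex.norm_real, norm_mul, norm_div, norm_pow, norm_neg,
      norm_one, one_pow, one_div]
    exact inv_mul_le_one
  rw [h2, h1, ← mul_assoc, norm_mul]
  refine (mul_le_of_le_one_left (norm_nonneg _) h3).trans (le_of_eq ?_)
  exact congrArg norm (integral_Lam_mul_fourierRiesz hs0 hui (hc.toSchwartzMap hφ))

/-- The additive form of the Cauchy-Schwarz bound suffices, because the term in `f` will be absorbed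
on the left. -/
lemma norm_integral_mul_le {f g : ℝ → ℂ} (hf : Integrable fun w => ‖f w‖ ^ 2)
    (hg : Integrable fun w => ‖g w‖ ^ 2) :
    ‖∫ w, f w * g w‖ ≤ ((∫ w, ‖f w‖ ^ 2) + ∫ w, ‖g w‖ ^ 2) / 2 := by
  rw [← integral_add hf hg, ← integral_div]
  refine norm_integral_le_of_norm_le ((hf.add hg).div_const 2) (Eventually.of_forall fun w => ?_)
  rw [norm_mul]
  nlinarith [sq_nonneg (‖f w‖ - ‖g w‖)]

lemma integral_multiplier_fourierExt {s : ℝ} {u : ℝ → ℂ}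
    (hi : Integrable (fun ξ : ℝ => |ξ| ^ (2 * s) * ‖fourierExt u ξ‖ ^ 2)) :
    Integrable (fun w : ℝ =>
      ‖((|2 * Real.pi * w| ^ s : ℝ) : ℂ) * fourierExt u (-(2 * Real.pi * w))‖ ^ 2) ∧
    ∫ w : ℝ, ‖((|2 * Real.pi * w| ^ s : ℝ) : ℂ) * fourierExt u (-(2 * Real.pi * w))‖ ^ 2 =
      seminormSq s u := by
  let F : ℝ → ℝ := fun ξ => |ξ| ^ (2 * s) * ‖fourierExt u ξ‖ ^ 2
  have e : ∀ w : ℝ, ‖((|2 * Real.pi * w| ^ s : ℝ) : ℂ) * fourierExt u (-(2 * Real.pi * w))‖ ^ 2 =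
      F (-(2 * Real.pi) * w) := by
    intro w
    simp only [F]
    rw [norm_mul, mul_pow, Complex.norm_real, Real.norm_of_nonneg (by positivity),
      ← Real.rpow_natCast, ← Real.rpow_mul (abs_nonneg _), neg_mul, abs_neg]
    congr 2; push_cast; ring
  have hπ : -(2 * Real.pi) ≠ 0 := by simp [Real.pi_ne_zero]
  simp only [e]
  refine ⟨hi.comp_mul_left' hπ, ?_⟩
  rw [Measure.integral_comp_mul_left F, abs_inv, abs_neg, abs_of_pos (by positivity), smul_eq_mul,
    seminormSq, one_div]

/-- The Riesz derivative on `Λ` is bounded by the seminorm of the zero extension. -/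
theorem normSq_rieszExpr_le {s : ℝ} (hs0 : 0 ≤ s) {u : ℝ → ℂ} {B : ℝ}
    (hu : ContDiffOn ℝ ∞ u Lam) (hB : ∀ x ∈ Lam, ‖u x‖ ≤ B)
    (hi : Integrable (fun ξ : ℝ => |ξ| ^ (2 * s) * ‖fourierExt u ξ‖ ^ 2)) :
    IntegrableOn (fun x => ‖rieszExpr s u x‖ ^ 2) Lam ∧
      normSq (rieszExpr s u) ≤ seminormSq s u := by
  obtain ⟨χ, hχ, hs, h01, h1⟩ := exists_cutoff
  set g := rieszExpr s u with hg
  have hgs : ContDiffOn ℝ ∞ g Lam := contDiffOn_rieszExpr s hu hB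
  have hgc : ContDiffOn ℝ ∞ (fun x => (starRingEnd ℂ) (g x)) Lam :=
    (Complex.conjCLE.contDiff).comp_contDiffOn hgs
  obtain ⟨hi1, hi2⟩ := integral_multiplier_fourierExt hi
  have hcut : ∀ n, ContDiff ℝ ∞ fun x => (χ n x : ℂ) * g x := fun n =>
    contDiff_cutoff_mul (hχ n) (hs n) hgs
  have hcutc : ∀ n, HasCompactSupport fun x => (χ n x : ℂ) * g x := fun n =>
    hasCompactSupport_of_tsupport_subset_Lam ((tsupport_cutoff_mul_subset _ _).trans (hs n))
  have hsq : ∀ n, Integrable fun x => ‖(χ n x : ℂ) * g x‖ ^ 2 := fun n => by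
    refine Continuous.integrable_of_hasCompactSupport ((hcut n).continuous.norm.pow 2) ?_
    exact (hcutc n).comp_left (g := fun z : ℂ => ‖z‖ ^ 2) (by simp)
  refine integral_normSq_le_of_tendsto (f := fun n x => (χ n x : ℂ) * g x)
    (B := fun _ => seminormSq s u) (fun n => (hcut n).continuous.aestronglyMeasurable)
    (fun n => (hsq n).integrableOn) (fun n => ?_) (ae_restrict_Lam fun x hx => ?_)
    tendsto_const_nhds
  · let φ : ℝ → ℂ := fun x => (χ n x : ℂ) * (starRingEnd ℂ) (g x)
    have hφ : ContDiff ℝ ∞ φ := contDiff_cutoff_mul (hχ n) (hs n) hgc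
    have hφs : tsupport φ ⊆ Lam := (tsupport_cutoff_mul_subset _ _).trans (hs n)
    have hφn : ∀ x, ‖φ x‖ = ‖(χ n x : ℂ) * g x‖ := fun x => by simp [φ]
    let f : SchwartzMap ℝ ℂ := (hasCompactSupport_of_tsupport_subset_Lam hφs).toSchwartzMap hφ
    have hA : ∫ x in Lam, g x * φ x = ((∫ x in Lam, χ n x * ‖g x‖ ^ 2 : ℝ) : ℂ) := by
      rw [← integral_complex_ofReal]
      congr 1; funext x
      simp only [φ]
      rw [mul_left_comm, Complex.mul_conj, Complex.normSq_eq_norm_sq]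
      push_cast; rfl
    have hAi : IntegrableOn (fun x => χ n x * ‖g x‖ ^ 2) Lam := by
      have h := (integrable_mul_of_tsupport hφ hφs hgs).norm
      refine (h.congr (Eventually.of_forall fun x => ?_)).integrableOn
      simp only [φ]
      rw [norm_mul, norm_mul, Complex.norm_real, Real.norm_of_nonneg (h01 n x).1,
        Complex.norm_conj]
      ring
    have hA0 : 0 ≤ ∫ x in Lam, χ n x * ‖g x‖ ^ 2 :=
      integral_nonneg fun x => mul_nonneg (h01 n x).1 (by positivity)
    have hBA : ∫ x in Lam, ‖(χ n x : ℂ) * g x‖ ^ 2 ≤ ∫ x in Lam, χ n x * ‖g x‖ ^ 2 := by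
      refine integral_mono (hsq n).integrableOn hAi fun x => ?_
      simp only
      rw [norm_mul, mul_pow, Complex.norm_real, Real.norm_of_nonneg (h01 n x).1, pow_two]
      exact mul_le_mul_of_nonneg_right (mul_le_of_le_one_left (h01 n x).1 (h01 n x).2) (by positivity)
    have hB2 : ∫ w, ‖(𝓕 f) w‖ ^ 2 = ∫ x in Lam, ‖(χ n x : ℂ) * g x‖ ^ 2 := by
      rw [SchwartzMap.integral_norm_sq_fourier, setIntegral_eq_integral_of_forall_compl_eq_zero]
      · congr 1; funext x; rw [← hφn]; rfl
      · intro x hx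
        rw [← hφn, image_eq_zero_of_notMem_tsupport fun h => hx (hφs h)]; simp
    change ∫ w, ‖𝓕 φ w‖ ^ 2 = _ at hB2
    have hfi : Integrable (fun w => ‖(𝓕 f) w‖ ^ 2) :=
      (memLp_two_iff_integrable_sq_norm (𝓕 f).continuous.aestronglyMeasurable).1
        ((𝓕 f).memLp 2 volume)
    have h3 := (integral_rieszExpr_mul hs0 hu hB hφ hφs).trans (norm_integral_mul_le hfi hi1)
    rw [← hg, hA, Complex.norm_real, Real.norm_of_nonneg hA0, hi2, hB2] at h3
    linarith
  · refine tendsto_const_nhds.congr' ?_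
    filter_upwards [h1 x hx] with n hn
    rw [hn]; simp

end RieszJacobi
end

/-! ### Existence of the limit at odd orders -/

noncomputable section
namespace RieszJacobi
open scoped ContDiff FourierTransform
open Complex (I)

lemma rpow_le_rpow_add_rpow {s a b c : ℝ} (hs : 0 < s) (hab : a ≤ b) (hbc : b ≤ c) :
    s ^ b ≤ s ^ a + s ^ c := by
  have h1 := Real.rpow_nonneg hs.le a
  have h2 := Real.rpow_nonneg hs.le c
  rcases le_total s 1 with h | h
  · have := Real.rpow_le_rpow_of_exponent_ge hs h hab
    linarith
  · have := Real.rpow_le_rpow_of_exponent_le h hbc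
    linarith

lemma tendsto_fourierRiesz {s₀ : ℝ} (h0 : 0 < s₀) (f : SchwartzMap ℝ ℂ) (x : ℝ) :
    Tendsto (fun s => fourierRiesz s f x) (𝓝 s₀) (𝓝 (fourierRiesz s₀ f x)) := by
  obtain ⟨n, hn⟩ := exists_nat_gt s₀
  refine tendsto_integral_filter_of_dominated_convergence _ ?_ ?_
    (integrable_multiplier_bound (𝓕 f) n) ?_
  · filter_upwards [lt_mem_nhds h0] with s hs
    exact (((continuous_multiplier hs.le).mul (𝓕 f).continuous).mul
      (continuous_chi_left x)).aestronglyMeasurable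
  · filter_upwards [lt_mem_nhds h0, gt_mem_nhds hn] with s hs hsn
    refine Eventually.of_forall fun w => ?_
    rw [norm_mul, norm_chi, mul_one, norm_mul]
    exact mul_le_mul_of_nonneg_right (norm_multiplier_le hs.le hsn.le w) (norm_nonneg _)
  · refine Eventually.of_forall fun w => Tendsto.mul_const _ (Tendsto.mul_const _ ?_)
    exact (Complex.continuous_ofReal.tendsto _).comp (Real.continuousAt_const_rpow' h0.ne').tendsto

/-- The part of a Riemann-Liouville derivative of order `s` that comes from the values of the
function at distance from `x`. -/
def farInt (s : ℝ) (v : ℝ → ℂ) (c x : ℝ) : ℂ :=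
  ∫ t in Ioc (-1) c, (((x - t) ^ (-s - 1) : ℝ) : ℂ) * v t

lemma tendsto_farInt {s₀ : ℝ} (h0 : 0 < s₀) {v : ℝ → ℂ} {c x : ℝ} (hv : IntegrableOn v (Ioc (-1) c))
    (hx : c < x) : Tendsto (fun s => farInt s v c x) (𝓝 s₀) (𝓝 (farInt s₀ v c x)) := by
  have hpos : 0 < x - c := by linarith
  refine tendsto_integral_filter_of_dominated_convergence
    (fun t => ((x - c) ^ (-(s₀ + 1) - 1) + (x - c) ^ (-1 : ℝ)) * ‖v t‖) ?_ ?_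
    (hv.norm.const_mul _) ?_
  · refine Eventually.of_forall fun s => ?_
    have : Measurable fun t : ℝ => (x - t) ^ (-s - 1) := (measurable_const.sub measurable_id).pow_const _
    exact (Complex.measurable_ofReal.comp this).aestronglyMeasurable.mul hv.aestronglyMeasurable
  · filter_upwards [lt_mem_nhds h0, gt_mem_nhds (lt_add_one s₀)] with s hs hs1
    refine (ae_restrict_iff' measurableSet_Ioc).2 (Eventually.of_forall fun t ht => ?_)
    have htx : x - c ≤ x - t := by linarith [ht.2]
    rw [norm_mul, Complex.norm_real, Real.norm_of_nonneg (Real.rpow_nonneg (hpos.le.trans htx) _)]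
    refine mul_le_mul_of_nonneg_right ?_ (norm_nonneg _)
    exact (Real.rpow_le_rpow_of_nonpos hpos htx (by linarith)).trans
      (rpow_le_rpow_add_rpow hpos (by linarith) (by linarith))
  · refine (ae_restrict_iff' measurableSet_Ioc).2 (Eventually.of_forall fun t ht => ?_)
    refine Tendsto.mul_const _ ((Complex.continuous_ofReal.tendsto _).comp ?_)
    have h1 : x - t ≠ 0 := by linarith [ht.2]
    exact (Real.continuousAt_const_rpow h1).tendsto.comp
      ((continuous_neg.sub continuous_const).tendsto s₀)

lemma IsCutoffAt.comp_neg {χ : ℝ → ℝ} {x₀ δ : ℝ} (h : IsCutoffAt χ x₀ δ) :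
    IsCutoffAt (fun x => χ (-x)) (-x₀) δ where
  contDiff := h.contDiff.comp contDiff_neg
  tsupport_subset := fun x hx => by
    have h1 := tsupport_comp_subset_preimage χ (continuous_neg (G := ℝ)) hx
    simpa using neg_mem_Lam (h.tsupport_subset h1)
  mem_Icc := fun x => h.mem_Icc (-x)
  pos := h.pos
  eq_one := fun x hx => h.eq_one (-x) (by
    rw [Metric.mem_ball, dist_eq_norm] at hx ⊢
    rwa [← norm_neg, show -(-x - x₀) = x - -x₀ by ring])

section

variable {u : ℝ → ℂ} {B : ℝ} {χ : ℝ → ℝ} {x₀ δ : ℝ}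

lemma leftDeriv_eq (s : ℝ) (hu : ContDiffOn ℝ ∞ u Lam) (hB : ∀ x ∈ Lam, ‖u x‖ ≤ B)
    (hχ : IsCutoffAt χ x₀ δ) :
    leftDeriv s u x₀ =
      lineInt (ceilOrder s - s) (iteratedDeriv (ceilOrder s) fun x => (χ x : ℂ) * u x) x₀ +
      (((Real.Gamma (ceilOrder s - s))⁻¹ : ℝ) : ℂ) *
        ((∏ i ∈ Finset.range (ceilOrder s), (ceilOrder s - s - 1 - i) : ℝ) : ℂ) *
        farInt s (fun t => (1 - (χ t : ℂ)) * u t) (x₀ - δ) x₀ := by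
  rw [leftDeriv, iteratedDeriv_leftInt (ceilOrder_sub_pos s) hu hB hχ, leftIntJet, farInt]
  congr 4
  funext t
  congr 3
  ring

/-- The two one-sided derivatives together, split into a local and a distant part. -/
lemma leftDeriv_add_rightDeriv (s : ℝ) (hs : 0 ≤ s) (hu : ContDiffOn ℝ ∞ u Lam)
    (hB : ∀ x ∈ Lam, ‖u x‖ ≤ B) (hχ : IsCutoffAt χ x₀ δ) :
    leftDeriv s u x₀ + rightDeriv s u x₀ =
      ((2 * Real.cos (Real.pi * s / 2) : ℝ) : ℂ) * fourierRiesz s (fun x => (χ x : ℂ) * u x) x₀ +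
      (((Real.Gamma (ceilOrder s - s))⁻¹ : ℝ) : ℂ) *
        ((∏ i ∈ Finset.range (ceilOrder s), (ceilOrder s - s - 1 - i) : ℝ) : ℂ) *
        (farInt s (fun t => (1 - (χ t : ℂ)) * u t) (x₀ - δ) x₀ +
          farInt s (fun t => (1 - (χ (-t) : ℂ)) * u (-t)) (-x₀ - δ) (-x₀)) := by
  have hn := leftDeriv_eq s (contDiffOn_comp_neg hu) (fun x hx => hB _ (neg_mem_Lam hx)) hχ.comp_neg
  have hsm := contDiff_cutoff_mul hχ.contDiff hχ.tsupport_subset hu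
  have hc := hasCompactSupport_of_tsupport_subset_Lam
    ((tsupport_cutoff_mul_subset χ u).trans hχ.tsupport_subset)
  have hl := lineInt_add_lineInt_neg hsm hc (ceilOrder_sub_pos s) (k := ceilOrder s)
    (by linarith) x₀
  rw [sub_sub_cancel] at hl
  rw [rightDeriv_eq, leftDeriv_eq s hu hB hχ, hn]
  linear_combination hl

end

lemma ceilOrder_eq {n : ℕ} {s : ℝ} (h1 : (n : ℝ) ≤ s) (h2 : s < n + 1) : ceilOrder s = n + 1 := by
  rw [ceilOrder, (Nat.floor_eq_iff ((Nat.cast_nonneg n).trans h1)).2 ⟨h1, h2⟩]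

/-- Near an odd integer the cosine has a simple zero. -/
lemma tendsto_div_cos (m : ℕ) : ∃ c : ℝ, Tendsto
    (fun r : ℝ => (2 * (m : ℝ) + 1 - r) / Real.cos (Real.pi * r / 2)) (𝓝[≠] (2 * m + 1)) (𝓝 c) := by
  set a : ℝ := 2 * m + 1
  have harg : Real.pi * a / 2 = Real.pi / 2 + m * Real.pi := by simp only [a]; ring
  have hcos : Real.cos (Real.pi * a / 2) = 0 := by
    rw [harg, Real.cos_add_nat_mul_pi, Real.cos_pi_div_two, mul_zero]
  have hsin : Real.sin (Real.pi * a / 2) ≠ 0 := by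
    rw [harg, Real.sin_add_nat_mul_pi, Real.sin_pi_div_two, mul_one]
    exact pow_ne_zero _ (by norm_num)
  have hd : HasDerivAt (fun r : ℝ => Real.cos (Real.pi * r / 2))
      (-Real.sin (Real.pi * a / 2) * (Real.pi / 2)) a := by
    have h1 : HasDerivAt (fun r : ℝ => Real.pi * r / 2) (Real.pi / 2) a := by
      simpa using ((hasDerivAt_id a).const_mul Real.pi).div_const 2
    exact h1.cos
  have hs := hasDerivAt_iff_tendsto_slope.1 hd
  have hne : -Real.sin (Real.pi * a / 2) * (Real.pi / 2) ≠ 0 :=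
    mul_ne_zero (neg_ne_zero.2 hsin) (by positivity)
  refine ⟨_, ((hs.inv₀ hne).neg).congr fun r => ?_⟩
  rw [slope_def_field, hcos, sub_zero, inv_div, ← neg_div, neg_sub]

theorem exists_tendsto_rieszExpr (m : ℕ) {u : ℝ → ℂ} {B : ℝ} (hu : ContDiffOn ℝ ∞ u Lam)
    (hB : ∀ x ∈ Lam, ‖u x‖ ≤ B) {x₀ : ℝ} (hx : x₀ ∈ Lam) :
    ∃ l : ℂ, Tendsto (fun r => rieszExpr r u x₀) (𝓝[>] (2 * m + 1 : ℝ)) (𝓝 l) := by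
  obtain ⟨χ, δ, hχ⟩ := exists_isCutoffAt hx
  obtain ⟨c, hc⟩ := tendsto_div_cos m
  set a : ℝ := 2 * m + 1 with ha
  have ha0 : 0 < a := by positivity
  have hsm := contDiff_cutoff_mul hχ.contDiff hχ.tsupport_subset hu
  have hcs := hasCompactSupport_of_tsupport_subset_Lam
    ((tsupport_cutoff_mul_subset χ u).trans hχ.tsupport_subset)
  have hfar : ∀ {v : ℝ → ℂ} {ψ : ℝ → ℝ} {y : ℝ}, ContDiffOn ℝ ∞ v Lam → (∀ x ∈ Lam, ‖v x‖ ≤ B) →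
      IsCutoffAt ψ y δ → Tendsto (fun r => farInt r (fun t => (1 - (ψ t : ℂ)) * v t) (y - δ) y)
        (𝓝 a) (𝓝 (farInt a (fun t => (1 - (ψ t : ℂ)) * v t) (y - δ) y)) := by
    intro v ψ y hv hvB hψ
    refine tendsto_farInt ha0 ((integrableOn_one_sub_cutoff_mul hv.continuousOn hvB hψ).mono_set ?_)
      (by linarith [hψ.pos])
    exact fun t ht => ⟨ht.1, by linarith [hψ.mem.2, hψ.pos, ht.2]⟩
  have t1 := (tendsto_fourierRiesz ha0 (hcs.toSchwartzMap hsm) x₀).mono_left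
    (nhdsWithin_le_nhds (s := Ioi a))
  have t2 := (hfar hu hB hχ).mono_left (nhdsWithin_le_nhds (s := Ioi a))
  have t3 := (hfar (contDiffOn_comp_neg hu) (fun x hx => hB _ (neg_mem_Lam hx))
    hχ.comp_neg).mono_left (nhdsWithin_le_nhds (s := Ioi a))
  have t4 : Tendsto (fun r : ℝ => (((Real.Gamma (a + 1 - r))⁻¹ : ℝ) : ℂ)) (𝓝[>] a)
      (𝓝 (((Real.Gamma (a + 1 - a))⁻¹ : ℝ) : ℂ)) := by
    refine Tendsto.mono_left ?_ nhdsWithin_le_nhds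
    refine (Complex.continuous_ofReal.tendsto _).comp (Tendsto.inv₀ ?_ ?_)
    · have h1 : ContinuousAt Real.Gamma (a + 1 - a) := by
        refine (Real.differentiableAt_Gamma fun k => ?_).continuousAt
        have : (0 : ℝ) ≤ k := Nat.cast_nonneg k
        linarith
      exact h1.tendsto.comp ((continuous_const.sub continuous_id).tendsto a)
    · rw [add_sub_cancel_left]; simp
  have t5 : Tendsto (fun r : ℝ => ((∏ i ∈ Finset.range (2 * m + 1), (a - r - (i + 1)) : ℝ) : ℂ))
      (𝓝[>] a) (𝓝 ((∏ i ∈ Finset.range (2 * m + 1), (a - a - (i + 1)) : ℝ) : ℂ)) := by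
    refine Tendsto.mono_left ?_ nhdsWithin_le_nhds
    have : Continuous fun r : ℝ =>
        ((∏ i ∈ Finset.range (2 * m + 1), (a - r - (i + 1)) : ℝ) : ℂ) := by fun_prop
    exact this.tendsto a
  have t6 : Tendsto (fun r : ℝ => (((a - r) / Real.cos (Real.pi * r / 2) : ℝ) : ℂ)) (𝓝[>] a)
      (𝓝 (c : ℂ)) :=
    (Complex.continuous_ofReal.tendsto _).comp
      (hc.mono_left (nhdsWithin_mono _ fun r (hr : a < r) => hr.ne'))
  -- After division by the cosine, the local part has no singular factor left, and the far part
  -- contains `(a - r) / cos(πr/2)`, which converges.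
  refine ⟨_, ((t1.add ((((t4.mul t5).mul t6).mul (t2.add t3)).div_const 2)).const_mul
    ((-1 : ℂ) ^ (m + 1))).congr' ?_⟩
  -- The zeros of the cosine are the odd integers, and none lies strictly between `a` and `a + 1`.
  have hcos : ∀ᶠ r in 𝓝[>] a, Real.cos (Real.pi * r / 2) ≠ 0 := by
    filter_upwards [Ioo_mem_nhdsGT (lt_add_one a)] with r hr h0
    rw [Real.cos_eq_zero_iff] at h0
    obtain ⟨j, hj⟩ := h0
    have h1 : r = 2 * j + 1 := by
      have := Real.pi_pos
      field_simp at hj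
      linarith
    have h2 : (2 * m + 1 : ℝ) < 2 * j + 1 := h1 ▸ hr.1
    have h3 : (2 * j + 1 : ℝ) < 2 * m + 1 + 1 := h1 ▸ hr.2
    have h4 : (m : ℤ) < j := by
      have : (m : ℝ) < j := by linarith
      exact_mod_cast this
    have h5 : (2 * j : ℤ) < 2 * m + 1 := by
      have : (2 * j : ℝ) < 2 * m + 1 := by linarith
      exact_mod_cast this
    omega
  filter_upwards [Ioo_mem_nhdsGT (lt_add_one a), hcos] with r hr hcr
  have hk : ceilOrder r = 2 * m + 1 + 1 :=
    ceilOrder_eq (by push_cast; exact hr.1.le) (by push_cast; exact hr.2)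
  have hk' : (ceilOrder r : ℝ) = a + 1 := by rw [hk]; push_cast; rw [ha]
  have hfl : ⌊(r + 1) / 2⌋₊ = m + 1 := by
    rw [Nat.floor_eq_iff (by linarith [hr.1])]
    push_cast
    constructor <;> linarith [hr.1, hr.2]
  -- Since `k = a + 1` on `(a, a + 1)`, the factor with `i = 0` is `a - r`; it compensates the
  -- simple zero of the cosine.
  have hprod : (∏ i ∈ Finset.range (ceilOrder r), ((ceilOrder r : ℝ) - r - 1 - i)) =
      (∏ i ∈ Finset.range (2 * m + 1), (a - r - (i + 1))) * (a - r) := by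
    rw [hk', hk, Finset.prod_range_succ']
    congr 1
    · refine Finset.prod_congr rfl fun i _ => ?_
      push_cast; ring
    · push_cast; ring
  rw [rieszExpr, leftDeriv_add_rightDeriv r (ha0.le.trans hr.1.le) hu hB hχ, hprod, hk', hfl]
  change _ * (fourierRiesz r (fun x => (χ x : ℂ) * u x) x₀ + _) = _
  generalize Real.cos (Real.pi * r / 2) = q at hcr ⊢
  have hq : (q : ℂ) ≠ 0 := by exact_mod_cast hcr
  push_cast
  field_simp

end RieszJacobi
end

/-! ### Passage to the limit in the order, and the conclusion -/

noncomputable section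
namespace RieszJacobi
open scoped ContDiff

section

variable {u : ℝ → ℂ} {B : ℝ}

lemma memLp_rieszExpr {s : ℝ} (hs : 0 ≤ s) (hu : ContDiffOn ℝ ∞ u Lam) (hB : ∀ x ∈ Lam, ‖u x‖ ≤ B)
    (hi : Integrable fun ξ : ℝ => |ξ| ^ (2 * s) * ‖fourierExt u ξ‖ ^ 2) :
    MemLp (rieszExpr s u) 2 (volume.restrict Lam) :=
  (memLp_two_iff_integrable_sq_norm
    ((contDiffOn_rieszExpr s hu hB).continuousOn.aestronglyMeasurable measurableSet_Ioo)).2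
    (normSq_rieszExpr_le hs hu hB hi).1

/-- Dominated convergence: off `ξ = 0`, a power with exponent between `2s` and `2c` is at most the
sum of the two extreme ones. -/
lemma tendsto_seminormSq {ι : Type*} {l : Filter ι} [l.IsCountablyGenerated] {s c : ℝ} {r : ι → ℝ}
    (hu : IntegrableOn u Lam) (hs : 0 < s)
    (hi : Integrable fun ξ : ℝ => |ξ| ^ (2 * s) * ‖fourierExt u ξ‖ ^ 2)
    (hic : Integrable fun ξ : ℝ => |ξ| ^ (2 * c) * ‖fourierExt u ξ‖ ^ 2)
    (hr : Tendsto r l (𝓝 s)) (hsr : ∀ j, s ≤ r j) (hrc : ∀ j, r j ≤ c) :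
    Tendsto (fun j => seminormSq (r j) u) l (𝓝 (seminormSq s u)) := by
  refine Tendsto.const_mul _ (tendsto_integral_filter_of_dominated_convergence _ ?_ ?_
    (hi.add hic) ?_)
  · refine Eventually.of_forall fun j => ?_
    have h1 : Measurable fun ξ : ℝ => |ξ| ^ (2 * r j) :=
      (continuous_abs.measurable).pow_const _
    exact (h1.mul ((continuous_fourierExt hu).norm.pow 2).measurable).aestronglyMeasurable
  · refine Eventually.of_forall fun j => ?_
    filter_upwards [compl_mem_ae_iff.2 (measure_singleton (0 : ℝ))] with ξ hξ
    have h0 : 0 < |ξ| := abs_pos.2 hξ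
    rw [Real.norm_of_nonneg (by positivity), Pi.add_apply, ← add_mul]
    exact mul_le_mul_of_nonneg_right
      (rpow_le_rpow_add_rpow h0 (by linarith [hsr j]) (by linarith [hrc j])) (by positivity)
  · refine Eventually.of_forall fun ξ => Tendsto.mul_const _ ?_
    exact (Real.continuousAt_const_rpow' (by positivity : 2 * s ≠ 0)).tendsto.comp (hr.const_mul 2)

/-- A pointwise limit of Riesz derivatives obeys the same bound by the seminorm. -/
lemma memLp_of_tendsto_rieszExpr {s c : ℝ} {g : ℝ → ℂ} (hs : 0 < s) (hsc : s < c)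
    (hu : ContDiffOn ℝ ∞ u Lam) (hB : ∀ x ∈ Lam, ‖u x‖ ≤ B)
    (hi : ∀ r, s ≤ r → r ≤ c → Integrable fun ξ : ℝ => |ξ| ^ (2 * r) * ‖fourierExt u ξ‖ ^ 2)
    (hg : ∀ x ∈ Lam, Tendsto (fun r => rieszExpr r u x) (𝓝[>] s) (𝓝 (g x))) :
    MemLp g 2 (volume.restrict Lam) ∧ normSq g ≤ seminormSq s u := by
  -- Fatou's lemma needs a sequence of orders decreasing to `s`; its upper bounds are the seminorms
  -- of order `r j`, which converge.
  obtain ⟨r, -, hr, hlim⟩ := exists_seq_strictAnti_tendsto' hsc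
  have hlim' : Tendsto r atTop (𝓝[>] s) :=
    tendsto_nhdsWithin_iff.2 ⟨hlim, Eventually.of_forall fun j => (hr j).1⟩
  have hir := fun j => hi (r j) (hr j).1.le (hr j).2.le
  have hae : ∀ᵐ x ∂volume.restrict Lam, Tendsto (fun j => rieszExpr (r j) u x) atTop (𝓝 (g x)) :=
    (ae_restrict_iff' measurableSet_Ioo).2
      (Eventually.of_forall fun x hx => (hg x hx).comp hlim')
  have hp := fun j => hs.le.trans (hr j).1.le
  have hm := fun j => (memLp_rieszExpr (hp j) hu hB (hir j)).aestronglyMeasurable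
  have hL : IntegrableOn u Lam :=
    integrableOn_Lam_of_bound hu.continuousOn hB
  obtain ⟨h1, h2⟩ := integral_normSq_le_of_tendsto hm
    (fun j => (normSq_rieszExpr_le (hp j) hu hB (hir j)).1)
    (fun j => (normSq_rieszExpr_le (hp j) hu hB (hir j)).2) hae
    (tendsto_seminormSq hL hs (hi s le_rfl hsc.le) (hi c hsc.le le_rfl) hlim
      (fun j => (hr j).1.le) fun j => (hr j).2.le)
  exact ⟨(memLp_two_iff_integrable_sq_norm (aestronglyMeasurable_of_tendsto_ae _ hm hae)).2 h1, h2⟩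

/-- The Riesz derivative of a bounded smooth function exists, and its norm is at most the
seminorm of the zero extension. -/
theorem rieszDefined_and_normSq_le {s c : ℝ} (hs : 0 < s) (hsc : s < c)
    (hu : ContDiffOn ℝ ∞ u Lam) (hB : ∀ x ∈ Lam, ‖u x‖ ≤ B)
    (hi : ∀ r, s ≤ r → r ≤ c → Integrable fun ξ : ℝ => |ξ| ^ (2 * r) * ‖fourierExt u ξ‖ ^ 2) :
    RieszDefined s u ∧ MemLp (rieszDeriv s u) 2 (volume.restrict Lam) ∧
      normSq (rieszDeriv s u) ≤ seminormSq s u := by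
  by_cases h : IsOddOrder s
  · have hl : ∀ x ∈ Lam, ∃ l : ℂ, Tendsto (fun r => rieszExpr r u x) (𝓝[>] s) (𝓝 l) := by
      obtain ⟨m, rfl⟩ := h
      exact fun x hx => exists_tendsto_rieszExpr m hu hB hx
    refine ⟨⟨fun h' => absurd h h', fun _ =>
      ⟨Eventually.of_forall fun r => RLDefined_of_contDiffOn r hu hB, hl⟩⟩,
      memLp_of_tendsto_rieszExpr hs hsc hu hB hi fun x hx => ?_⟩
    rw [rieszDeriv, if_pos h]
    exact tendsto_nhds_limUnder (hl x hx)
  · have he : rieszDeriv s u = rieszExpr s u := funext fun x => if_neg h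
    have h1 := hi s le_rfl hsc.le
    rw [he]
    exact ⟨⟨fun _ => RLDefined_of_contDiffOn s hu hB, fun h' => absurd h' h⟩,
      memLp_rieszExpr hs.le hu hB h1, (normSq_rieszExpr_le hs.le hu hB h1).2⟩

end

end RieszJacobi
end

theorem mainTheorem3 (α : ℝ) (hα : 0 < α) :
    ∃ C : ℝ, 0 < C ∧ ∀ N : ℕ, 1 ≤ N → ∀ u ∈ RieszJacobi.FN α N,
      -- the classical Riesz derivative on the interval, in the norm of `L²(-1, 1)`
      (RieszJacobi.RieszDefined α u ∧
        MemLp (RieszJacobi.rieszDeriv α u) 2 (volume.restrict RieszJacobi.Lam) ∧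
        RieszJacobi.normSq (RieszJacobi.rieszDeriv α u)
          ≤ C * (N : ℝ) ^ (4 * α) * RieszJacobi.normSq u) ∧
      -- the same derivative of the zero extension, in the norm of `L²(ℝ)`, by Parseval
      (Integrable (fun ξ : ℝ => |ξ| ^ (2 * α) * ‖RieszJacobi.fourierExt u ξ‖ ^ 2) ∧
        RieszJacobi.seminormSq α u
          ≤ C * (N : ℝ) ^ (4 * α) * RieszJacobi.normSq u) := by
  obtain ⟨C, hC, h⟩ := RieszJacobi.exists_seminormSq_le hα
  refine ⟨C, hC, fun N hN u huN => ?_⟩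
  obtain ⟨p, hp, rfl⟩ := RieszJacobi.exists_eq_weighted huN
  obtain ⟨⟨D, -, hD⟩, hle⟩ := h N hN p hp
  obtain ⟨x₀, -, hx₀⟩ := RieszJacobi.exists_bound_eval p
  have hu : ContDiffOn ℝ (⊤ : ℕ∞) (RieszJacobi.weighted α p) RieszJacobi.Lam :=
    RieszJacobi.contDiffOn_weighted α p
  have hB : ∀ x ∈ RieszJacobi.Lam, ‖RieszJacobi.weighted α p x‖ ≤ ‖p.eval (x₀ : ℂ)‖ :=
    fun x hx => RieszJacobi.norm_weighted_le hα hx₀ hx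
  have hL : IntegrableOn (RieszJacobi.weighted α p) RieszJacobi.Lam :=
    RieszJacobi.integrableOn_Lam_of_bound hu.continuousOn hB
  have hN1 : (1 : ℝ) ≤ (N : ℝ) ^ 2 := one_le_pow₀ (by exact_mod_cast hN)
  have hsq := (RieszJacobi.integral_normSq_fourierExt_le hu hB).1
  -- Any margin below `1/2` would do, since the decay `|ξ|^{-α-1}` allows all `r < α + 1/2`.
  have hi : ∀ r, α ≤ r → r ≤ α + 1 / 4 → Integrable fun ξ : ℝ =>
      |ξ| ^ (2 * r) * ‖RieszJacobi.fourierExt (RieszJacobi.weighted α p) ξ‖ ^ 2 :=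
    fun r h1 h2 => RieszJacobi.integrable_pow_mul_normSq hN1 (hα.le.trans h1) (by linarith)
      (RieszJacobi.continuous_fourierExt hL) hsq hD
  obtain ⟨h1, h2, h3⟩ := RieszJacobi.rieszDefined_and_normSq_le hα
    (by linarith : α < α + 1 / 4) hu hB hi
  exact ⟨⟨h1, h2, h3.trans hle⟩, hi α le_rfl (by linarith), hle⟩
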